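/- Let $\Gamma$ be a finite compact metric graph with $N$ vertices: a finite nonempty family of compact intervals $[a_j,b_j]$, $a_j<b_j$, $j=1,\dots,n$ (the edges), with a partition of the set of their $2n$ endpoints into $N$ nonempty classes $V_1,\dots,V_N$ (the vertices; loops, multiple edges and disconnected graphs are allowed). Let $\gamma_k=|V_k|$ be the valence of $V_k$ and $\Gamma_N=\mathrm{diag}\{\gamma_1,\dots,\gamma_N\}$. For a function $f$ on the edges let $\partial_n f(x)=f'(x)$ if $x$ is the left endpoint of its edge and $\partial_n f(x)=-f'(x)$ if $x$ is the right endpoint. For real $\beta_1,\dots,\beta_N$ and $B=\mathrm{diag}\{\beta_1,\dots,\beta_N\}$, the graph Laplacian $A_B$ with $\delta'$-type matching conditions is the operator $f\mapsto -f''$ in $L_2(\Gamma)=\bigoplus_{j=1}^n L_2[a_j,b_j]$ (complex-valued functions) on the domain of all $f\in\bigoplus_{j=1}^n W_2^2[a_j,b_j]$ such that for every $k=1,\dots,N$ the normal derivative $\partial_n f$ takes one and the same value $\partial_n f(V_k)$ at all endpoints in $V_k$ and $$\sum_{x\in V_k} f(x)=\beta_k\,\partial_n f(V_k).$$ Let $B_1=\mathrm{diag}\{\tilde\alpha_1,\dots,\tilde\alpha_N\}$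 and $B_2=\mathrm{diag}\{\alpha_1,\dots,\alpha_N\}$ be real and invertible, and suppose that the (point) spectra of $A_{B_1}$ and $A_{B_2}$ coincide counting multiplicities, i.e. $\dim\ker(A_{B_1}-\lambda)=\dim\ker(A_{B_2}-\lambda)$ for every $\lambda\in\mathbb C$. Then for every integer $m\ge 1$ $$\sum_{j=1}^{m}\frac{(-1)^j}{j}\binom{m-1}{m-j}\,\mathrm{Tr}\left(D^j B_2^{-m+j}\,\Gamma_N^{m}\right)=0,\qquad D:=B_2^{-1}-B_1^{-1}.$$ -/

import Mathlib

open MeasureTheory Set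

noncomputable section

namespace QuantumGraph

/-- A finite compact metric graph with `n ≥ 1` edges and `N` vertices. The edges are the intervals
`[left j, right j]` of positive length. The set of the `2n` edge endpoints is `Fin n × Bool`, where
`(j, false)` is the left and `(j, true)` the right endpoint of the edge `j`, and `vertexOf` is its
partition into the (nonempty) classes `0, …, N - 1`, called vertices. Loops, multiple edges and
disconnected graphs are allowed. -/
structure MetricGraph (n N : ℕ) where
  left : Fin n → ℝ
  right : Fin n → ℝ
  left_lt_right : ∀ j, left j < right j
  edges_nonempty : 0 < n
  vertexOf : Fin n × Bool → Fin N
  vertexOf_surjective : Function.Surjective vertexOf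

variable {n N : ℕ}

namespace MetricGraph

/-- The class of endpoints that makes up the vertex `v`. -/
def endpointsAt (Γ : MetricGraph n N) (v : Fin N) : Finset (Fin n × Bool) :=
  Finset.univ.filter (fun p => Γ.vertexOf p = v)

/-- The valence of a vertex: the number of endpoints in it. -/
def valence (Γ : MetricGraph n N) (v : Fin N) : ℕ := (Γ.endpointsAt v).card

/-- The diagonal matrix of valences. -/
def valenceMatrix (Γ : MetricGraph n N) : Matrix (Fin N) (Fin N) ℝ :=
  Matrix.diagonal (fun v => (Γ.valence v : ℝ))

/-- The Hilbert space `L₂(Γ)`, the orthogonal sum of the spaces `L₂` of the edges. -/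
abbrev L2 (Γ : MetricGraph n N) : Type :=
  PiLp 2 (fun j : Fin n => Lp ℂ 2 (volume.restrict (Icc (Γ.left j) (Γ.right j))))

/-- The value of `F` at an endpoint. -/
def endpointValue (Γ : MetricGraph n N) (F : Fin n → ℝ → ℂ) (p : Fin n × Bool) : ℂ :=
  if p.2 then F p.1 (Γ.right p.1) else F p.1 (Γ.left p.1)

/-- The normal derivative at an endpoint of a function whose derivative is `F'`: it is `F'` at a
left endpoint and `-F'` at a right one. -/
def normalDeriv (Γ : MetricGraph n N) (F' : Fin n → ℝ → ℂ) (p : Fin n × Bool) : ℂ :=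
  if p.2 then -F' p.1 (Γ.right p.1) else F' p.1 (Γ.left p.1)

end MetricGraph

/-- `F` belongs to the Sobolev space `W₂²[a, b]`, with first and second derivatives `F'`, `F''`:
`F''` is square integrable on `[a, b]`, and `F`, `F'` are the absolutely continuous functions on
`[a, b]` that are the indefinite integrals of `F'`, `F''`. -/
structure IsSobolev22 (a b : ℝ) (F F' F'' : ℝ → ℂ) : Prop where
  memLp : MemLp F'' 2 (volume.restrict (Icc a b))
  deriv_eq : ∀ x ∈ Icc a b, F' x = F' a + ∫ t in a..x, F'' t
  fun_eq : ∀ x ∈ Icc a b, F x = F a + ∫ t in a..x, F' t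

/-- The `δ'`-type matching condition at the vertex `v` with coupling constant `c`, for a function
`F` with derivative `F'`: the normal derivative has one and the same value `d` at all endpoints in
`v`, and the sum of the values of the function at these endpoints is `c * d`. -/
def DeltaPrimeMatching (Γ : MetricGraph n N) (v : Fin N) (c : ℝ) (F F' : Fin n → ℝ → ℂ) : Prop :=
  ∃ d : ℂ, (∀ p ∈ Γ.endpointsAt v, Γ.normalDeriv F' p = d) ∧
    ∑ p ∈ Γ.endpointsAt v, Γ.endpointValue F p = (c : ℂ) * d

/-- The pair `(f, g)` of elements of `L₂(Γ)` satisfies: `f` belongs on each edge to `W₂²`, it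
satisfies the `δ'`-type matching conditions with coupling constants `α` at all vertices, and
`g = -f''`. Values at endpoints are those of the continuously differentiable representative. -/
def IsLaplacianPair (Γ : MetricGraph n N) (α : Fin N → ℝ) (f g : Γ.L2) : Prop :=
  ∃ F F' F'' : Fin n → ℝ → ℂ,
    (∀ j, IsSobolev22 (Γ.left j) (Γ.right j) (F j) (F' j) (F'' j)) ∧
    (∀ v, DeltaPrimeMatching Γ v (α v) F F') ∧
    (∀ j, (f j : ℝ → ℂ) =ᵐ[volume.restrict (Icc (Γ.left j) (Γ.right j))] F j) ∧
    (∀ j, (g j : ℝ → ℂ) =ᵐ[volume.restrict (Icc (Γ.left j) (Γ.right j))] fun x => -F'' j x)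

theorem continuousOn_primitive_of_integrableOn {a b : ℝ} {g : ℝ → ℂ}
    (h : IntegrableOn g (Icc a b)) : ContinuousOn (fun x => ∫ t in a..x, g t) (Icc a b) := by
  refine (intervalIntegral.continuousOn_primitive_Icc h).congr fun x hx => ?_
  simp only
  rw [intervalIntegral.integral_of_le hx.1, integral_Icc_eq_integral_Ioc]

theorem ae_eq_zero_of_primitive_eq_zero {a b : ℝ} (hab : a ≤ b) {g : ℝ → ℂ}
    (hg : IntegrableOn g (Icc a b)) (h0 : ∀ x ∈ Icc a b, ∫ t in a..x, g t = 0) :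
    ∀ᵐ x ∂(volume.restrict (Icc a b)), g x = 0 := by
  have hi : IntervalIntegrable g volume a b :=
    (intervalIntegrable_iff_integrableOn_Icc_of_le hab).2 hg
  rw [ae_restrict_iff' measurableSet_Icc]
  have ha : ∀ᵐ x : ℝ, x ≠ a := by simp [ae_iff, measure_singleton]
  have hb : ∀ᵐ x : ℝ, x ≠ b := by simp [ae_iff, measure_singleton]
  filter_upwards [hi.ae_hasDerivAt_integral, ha, hb] with x hx hxa hxb hxI
  have h1 := hx (by rwa [uIcc_of_le hab]) a left_mem_uIcc
  have hxo : x ∈ Ioo a b := ⟨lt_of_le_of_ne hxI.1 (Ne.symm hxa), lt_of_le_of_ne hxI.2 hxb⟩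
  have h2 : (fun y => ∫ t in a..y, g t) =ᶠ[nhds x] fun _ => (0 : ℂ) := by
    filter_upwards [isOpen_Ioo.mem_nhds hxo] with y hy
    exact h0 y (Ioo_subset_Icc_self hy)
  exact (h1.congr_of_eventuallyEq h2.symm).unique (hasDerivAt_const x (0 : ℂ))

theorem IsSobolev22.intervalIntegrable {a b : ℝ} {F F' F'' : ℝ → ℂ} (h : IsSobolev22 a b F F' F'')
    {x : ℝ} (hx : x ∈ Icc a b) : IntervalIntegrable F'' volume a x := by
  have h1 : IntegrableOn F'' (Icc a b) := h.memLp.integrable (by norm_num)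
  rw [intervalIntegrable_iff_integrableOn_Icc_of_le hx.1]
  exact h1.mono_set (Icc_subset_Icc_right hx.2)

theorem IsSobolev22.continuousOn_deriv {a b : ℝ} {F F' F'' : ℝ → ℂ}
    (h : IsSobolev22 a b F F' F'') : ContinuousOn F' (Icc a b) := by
  have h1 : IntegrableOn F'' (Icc a b) := h.memLp.integrable (by norm_num)
  have h2 : ContinuousOn (fun x => F' a + ∫ t in a..x, F'' t) (Icc a b) :=
    continuousOn_const.add (continuousOn_primitive_of_integrableOn h1)
  exact h2.congr h.deriv_eq

theorem IsSobolev22.intervalIntegrable_deriv {a b : ℝ} {F F' F'' : ℝ → ℂ}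
    (h : IsSobolev22 a b F F' F'') {x : ℝ} (hx : x ∈ Icc a b) :
    IntervalIntegrable F' volume a x := by
  apply ContinuousOn.intervalIntegrable
  rw [uIcc_of_le hx.1]
  exact h.continuousOn_deriv.mono (Icc_subset_Icc_right hx.2)

theorem IsSobolev22.continuousOn {a b : ℝ} {F F' F'' : ℝ → ℂ}
    (h : IsSobolev22 a b F F' F'') : ContinuousOn F (Icc a b) := by
  have h1 : IntegrableOn F' (Icc a b) := h.continuousOn_deriv.integrableOn_Icc
  have h2 : ContinuousOn (fun x => F a + ∫ t in a..x, F' t) (Icc a b) :=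
    continuousOn_const.add (continuousOn_primitive_of_integrableOn h1)
  exact h2.congr h.fun_eq

theorem IsSobolev22.add {a b : ℝ} {F F' F'' G G' G'' : ℝ → ℂ} (hF : IsSobolev22 a b F F' F'')
    (hG : IsSobolev22 a b G G' G'') :
    IsSobolev22 a b (fun x => F x + G x) (fun x => F' x + G' x) (fun x => F'' x + G'' x) where
  memLp := hF.memLp.add hG.memLp
  deriv_eq x hx := by
    rw [intervalIntegral.integral_add (hF.intervalIntegrable hx) (hG.intervalIntegrable hx),
      hF.deriv_eq x hx, hG.deriv_eq x hx]
    ring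
  fun_eq x hx := by
    rw [intervalIntegral.integral_add (hF.intervalIntegrable_deriv hx)
      (hG.intervalIntegrable_deriv hx), hF.fun_eq x hx, hG.fun_eq x hx]
    ring

theorem IsSobolev22.const_mul {a b : ℝ} {F F' F'' : ℝ → ℂ} (hF : IsSobolev22 a b F F' F'')
    (c : ℂ) :
    IsSobolev22 a b (fun x => c * F x) (fun x => c * F' x) (fun x => c * F'' x) where
  memLp := hF.memLp.const_mul c
  deriv_eq x hx := by
    rw [intervalIntegral.integral_const_mul, hF.deriv_eq x hx]
    ring
  fun_eq x hx := by
    rw [intervalIntegral.integral_const_mul, hF.fun_eq x hx]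
    ring

theorem DeltaPrimeMatching.add {Γ : MetricGraph n N} {v : Fin N} {c : ℝ}
    {F F' G G' : Fin n → ℝ → ℂ} (hF : DeltaPrimeMatching Γ v c F F')
    (hG : DeltaPrimeMatching Γ v c G G') :
    DeltaPrimeMatching Γ v c (fun j x => F j x + G j x) (fun j x => F' j x + G' j x) := by
  obtain ⟨d, hd, hs⟩ := hF
  obtain ⟨e, he, ht⟩ := hG
  refine ⟨d + e, fun p hp => ?_, ?_⟩
  · rw [← hd p hp, ← he p hp]
    unfold MetricGraph.normalDeriv
    split_ifs <;> ring
  · rw [mul_add, ← hs, ← ht, ← Finset.sum_add_distrib]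
    refine Finset.sum_congr rfl fun p _ => ?_
    unfold MetricGraph.endpointValue
    split_ifs <;> rfl

theorem DeltaPrimeMatching.const_mul {Γ : MetricGraph n N} {v : Fin N} {c : ℝ}
    {F F' : Fin n → ℝ → ℂ} (hF : DeltaPrimeMatching Γ v c F F') (z : ℂ) :
    DeltaPrimeMatching Γ v c (fun j x => z * F j x) (fun j x => z * F' j x) := by
  obtain ⟨d, hd, hs⟩ := hF
  refine ⟨z * d, fun p hp => ?_, ?_⟩
  · rw [← hd p hp]
    unfold MetricGraph.normalDeriv
    split_ifs <;> ring
  · rw [mul_left_comm, ← hs, Finset.mul_sum]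
    refine Finset.sum_congr rfl fun p _ => ?_
    unfold MetricGraph.endpointValue
    split_ifs <;> rfl

/-- The graph, as a subspace of `L₂(Γ) × L₂(Γ)`, of the graph Laplacian. -/
def laplacianGraph (Γ : MetricGraph n N) (α : Fin N → ℝ) : Submodule ℂ (Γ.L2 × Γ.L2) where
  carrier := {q | IsLaplacianPair Γ α q.1 q.2}
  zero_mem' := by
    refine ⟨fun _ _ => 0, fun _ _ => 0, fun _ _ => 0, fun j => ⟨?_, ?_, ?_⟩,
      fun v => ⟨0, ?_, ?_⟩, fun j => ?_, fun j => ?_⟩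
    · exact MemLp.zero'
    · simp
    · simp
    · simp [MetricGraph.normalDeriv]
    · simp [MetricGraph.endpointValue]
    · exact Lp.coeFn_zero _ _ _
    · filter_upwards [Lp.coeFn_zero ℂ 2 (volume.restrict (Icc (Γ.left j) (Γ.right j)))] with x hx
      simpa using hx
  add_mem' := by
    rintro ⟨f, g⟩ ⟨f₁, g₁⟩ ⟨F, F', F'', h1, h2, h3, h4⟩ ⟨G, G', G'', k1, k2, k3, k4⟩
    refine ⟨fun j x => F j x + G j x, fun j x => F' j x + G' j x, fun j x => F'' j x + G'' j x,
      fun j => (h1 j).add (k1 j), fun v => (h2 v).add (k2 v), fun j => ?_, fun j => ?_⟩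
    · refine (Lp.coeFn_add (f j) (f₁ j)).trans ?_
      filter_upwards [h3 j, k3 j] with x hx kx
      simp only [Pi.add_apply] at *
      rw [hx, kx]
    · refine (Lp.coeFn_add (g j) (g₁ j)).trans ?_
      filter_upwards [h4 j, k4 j] with x hx kx
      simp only [Pi.add_apply] at *
      rw [hx, kx]
      ring
  smul_mem' := by
    rintro c ⟨f, g⟩ ⟨F, F', F'', h1, h2, h3, h4⟩
    refine ⟨fun j x => c * F j x, fun j x => c * F' j x, fun j x => c * F'' j x,
      fun j => (h1 j).const_mul c, fun v => (h2 v).const_mul c, fun j => ?_, fun j => ?_⟩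
    · refine (Lp.coeFn_smul c (f j)).trans ?_
      filter_upwards [h3 j] with x hx
      simp only [Pi.smul_apply, smul_eq_mul] at *
      rw [hx]
    · refine (Lp.coeFn_smul c (g j)).trans ?_
      filter_upwards [h4 j] with x hx
      simp only [Pi.smul_apply, smul_eq_mul] at *
      rw [hx]
      ring

/-- The graph Laplacian on `Γ` with `δ'`-type matching conditions and coupling constants `α`: the
unbounded operator `f ↦ -f''` in `L₂(Γ)` on the functions that are `W₂²` on every edge and satisfy
the matching conditions at every vertex. That its graph is `laplacianGraph Γ α` is
`laplacian_graph` below. -/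
def laplacian (Γ : MetricGraph n N) (α : Fin N → ℝ) : Γ.L2 →ₗ.[ℂ] Γ.L2 :=
  (laplacianGraph Γ α).toLinearPMap

/-- A function that vanishes almost everywhere has vanishing second derivative. -/
theorem IsSobolev22.second_deriv_ae_eq_zero {a b : ℝ} (hab : a < b) {F F' F'' : ℝ → ℂ}
    (h : IsSobolev22 a b F F' F'') (h0 : F =ᵐ[volume.restrict (Icc a b)] fun _ => 0) :
    ∀ᵐ x ∂(volume.restrict (Icc a b)), F'' x = 0 := by
  have hF : EqOn F (fun _ => 0) (Icc a b) :=
    Measure.eqOn_Icc_of_ae_eq volume hab.ne h0 h.continuousOn continuousOn_const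
  have hF'ae : F' =ᵐ[volume.restrict (Icc a b)] fun _ => 0 := by
    refine ae_eq_zero_of_primitive_eq_zero hab.le h.continuousOn_deriv.integrableOn_Icc
      fun x hx => ?_
    have h1 := h.fun_eq x hx
    rw [hF hx, hF (left_mem_Icc.2 hab.le)] at h1
    simpa using h1.symm
  have hF' : EqOn F' (fun _ => 0) (Icc a b) :=
    Measure.eqOn_Icc_of_ae_eq volume hab.ne hF'ae h.continuousOn_deriv continuousOn_const
  refine ae_eq_zero_of_primitive_eq_zero hab.le (h.memLp.integrable (by norm_num)) fun x hx => ?_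
  have h1 := h.deriv_eq x hx
  rw [hF' hx, hF' (left_mem_Icc.2 hab.le)] at h1
  simpa using h1.symm

theorem laplacian_graph (Γ : MetricGraph n N) (α : Fin N → ℝ) :
    (laplacian Γ α).graph = laplacianGraph Γ α := by
  refine Submodule.toLinearPMap_graph_eq _ ?_
  rintro ⟨f, g⟩ ⟨F, F', F'', h1, -, h3, h4⟩ hf
  obtain rfl : f = 0 := hf
  refine PiLp.ext fun j => Lp.ext ?_
  have hz : F j =ᵐ[volume.restrict (Icc (Γ.left j) (Γ.right j))] fun _ => 0 :=
    (h3 j).symm.trans (Lp.coeFn_zero _ _ _)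
  refine Filter.EventuallyEq.trans ?_ (Lp.coeFn_zero _ _ _).symm
  filter_upwards [h4 j, (h1 j).second_deriv_ae_eq_zero (Γ.left_lt_right j) hz] with x hx hx0
  rw [hx, hx0]
  simp

/-- The eigenspace `ker (A - z)` of an unbounded operator `A`. -/
def eigenspace {H : Type*} [AddCommGroup H] [Module ℂ H] (A : H →ₗ.[ℂ] H) (z : ℂ) :
    Submodule ℂ H where
  carrier := {f | (f, z • f) ∈ A.graph}
  zero_mem' := by
    have h : ((0 : H), z • (0 : H)) = 0 := by simp
    rw [mem_ofPred_eq, h]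
    exact A.graph.zero_mem
  add_mem' := by
    intro f g hf hg
    simpa [smul_add] using A.graph.add_mem hf hg
  smul_mem' := by
    intro c f hf
    simpa [smul_comm z c f] using A.graph.smul_mem c hf

/-- The point spectrum counting multiplicities, as a function: to each complex number its multiplicity as an
eigenvalue of `A`, the dimension of the eigenspace (which is `0` off the point spectrum). -/
def spectralMultiplicity {H : Type*} [AddCommGroup H] [Module ℂ H] (A : H →ₗ.[ℂ] H) (z : ℂ) :
    Cardinal :=
  Module.rank ℂ (eigenspace A z)

end QuantumGraph

end

/-! The spectrum with multiplicities determines the numbers `γ_k / β_k` as a multiset, and the trace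
formula is a binomial rewriting of the equality of their `m`-th power sums.

The solutions of `-f'' = z f` on the edges have coefficients that depend entirely on `z`, so
eigenfunctions are the kernel of a finite matrix `charMatrix` with entire entries. Symmetry of the
operator, in the form of Green's identity, excludes Jordan chains. Hence the order of each zero of
the determinant is the multiplicity of the eigenvalue (`analyticOrderAt_det_charMatrix`,
`spectralMultiplicity_laplacian`), and for isospectral operators the quotient of the two
determinants is entire.

The two matrices differ only in the vertex block, so the quotient is an `N × N` determinant built
from the vertex block of an inverse, and Green's identity bounds that block by a multiple of `(1 +
‖z‖)² / |Im z|`. An entire function with such growth is a polynomial. The argument is symmetric in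
the two operators, so the quotient is a unit, that is, a nonzero constant
(`exists_const_mul_det_charMatrix`).

At `z = -s²` with `s → ∞` the endpoints decouple up to exponentially small errors. After removal of
a factor common to both operators the determinant is asymptotic to `∏ (β_k s + γ_k)`. These two
polynomials are therefore proportional and have the same roots `-γ_k / β_k`
(`sum_valence_div_pow_eq`). -/

noncomputable section

namespace QuantumGraph

open Filter Topology Matrix ComplexConjugate Asymptotics

variable {n N : ℕ}

/-! ### Fundamental solutions of `-y'' = z y`, entire in `z`. -/

/-- The entire function `cos √z`. -/
def cosSqrt (z : ℂ) : ℂ := ∑' k : ℕ, (-z) ^ k / ((2 * k).factorial : ℂ)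

/-- The entire function `sin √z / √z`. -/
def sincSqrt (z : ℂ) : ℂ := ∑' k : ℕ, (-z) ^ k / ((2 * k + 1).factorial : ℂ)

theorem differentiable_tsum_neg_pow_div_factorial (e : ℕ → ℕ) (he : ∀ k, k ≤ e k) :
    Differentiable ℂ fun z : ℂ => ∑' k : ℕ, (-z) ^ k / ((e k).factorial : ℂ) := by
  intro z
  have hs : Summable fun k : ℕ => (‖z‖ + 1) ^ k / (k.factorial : ℝ) :=
    Real.summable_pow_div_factorial _
  have h := Complex.differentiableOn_tsum_of_summable_norm (U := Metric.ball (0 : ℂ) (‖z‖ + 1))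
    (F := fun k z => (-z) ^ k / ((e k).factorial : ℂ)) hs
    (fun k => by fun_prop) Metric.isOpen_ball ?_
  · exact (h.differentiableAt (Metric.isOpen_ball.mem_nhds (by simp)))
  · intro k w hw
    have hw' : ‖w‖ ≤ ‖z‖ + 1 := by simpa using (mem_ball_zero_iff.1 hw).le
    rw [norm_div, norm_pow, norm_neg, Complex.norm_natCast]
    have h1 : (k.factorial : ℝ) ≤ ((e k).factorial : ℝ) := by
      exact_mod_cast Nat.factorial_le (he k)
    gcongr

theorem differentiable_cosSqrt : Differentiable ℂ cosSqrt :=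
  differentiable_tsum_neg_pow_div_factorial (fun k => 2 * k) fun k => by lia

theorem differentiable_sincSqrt : Differentiable ℂ sincSqrt :=
  differentiable_tsum_neg_pow_div_factorial (fun k => 2 * k + 1) fun k => by lia

theorem cosSqrt_sq (k : ℂ) : cosSqrt (k ^ 2) = Complex.cos k := by
  rw [← (Complex.hasSum_cos k).tsum_eq]
  refine tsum_congr fun m => ?_
  rw [neg_pow, ← pow_mul]

theorem mul_sincSqrt_sq (k : ℂ) : k * sincSqrt (k ^ 2) = Complex.sin k := by
  rw [← (Complex.hasSum_sin k).tsum_eq, sincSqrt, ← tsum_mul_left]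
  refine tsum_congr fun m => ?_
  rw [neg_pow, ← pow_mul, pow_succ]
  ring

theorem sincSqrt_zero : sincSqrt 0 = 1 := by
  rw [sincSqrt, tsum_eq_single 0]
  · simp
  · intro k hk
    simp [hk]

theorem continuous_cosSqrt : Continuous cosSqrt := differentiable_cosSqrt.continuous

theorem continuous_sincSqrt : Continuous sincSqrt := differentiable_sincSqrt.continuous

/-- The solution of `-y'' = z y` with `y 0 = 1`, `y' 0 = 0`. -/
def cosSol (z : ℂ) (t : ℝ) : ℂ := cosSqrt (z * (t : ℂ) ^ 2)

/-- The solution of `-y'' = z y` with `y 0 = 0`, `y' 0 = 1`. -/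
def sinSol (z : ℂ) (t : ℝ) : ℂ := (t : ℂ) * sincSqrt (z * (t : ℂ) ^ 2)

theorem cosSol_sq (k : ℂ) (t : ℝ) : cosSol (k ^ 2) t = Complex.cos (k * t) := by
  rw [cosSol, ← mul_pow, cosSqrt_sq]

theorem mul_sinSol_sq (k : ℂ) (t : ℝ) : k * sinSol (k ^ 2) t = Complex.sin (k * t) := by
  rw [sinSol, ← mul_pow, ← mul_sincSqrt_sq]
  ring

theorem cosSol_zero_right (z : ℂ) : cosSol z 0 = 1 := by
  have h := cosSqrt_sq 0
  simpa [cosSol] using h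

theorem sinSol_zero_right (z : ℂ) : sinSol z 0 = 0 := by simp [sinSol]

theorem cosSol_zero_left (t : ℝ) : cosSol 0 t = 1 := by
  have h := cosSqrt_sq 0
  simpa [cosSol] using h

theorem sinSol_zero_left (t : ℝ) : sinSol 0 t = t := by simp [sinSol, sincSqrt_zero]

theorem differentiable_cosSol (t : ℝ) : Differentiable ℂ fun z => cosSol z t :=
  differentiable_cosSqrt.comp (differentiable_id.mul_const _)

theorem differentiable_sinSol (t : ℝ) : Differentiable ℂ fun z => sinSol z t :=
  (differentiable_sincSqrt.comp (differentiable_id.mul_const _)).const_mul _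

theorem continuous_cosSol_comp {X : Type*} [TopologicalSpace X] {z : X → ℂ} {t : X → ℝ}
    (hz : Continuous z) (ht : Continuous t) : Continuous fun x => cosSol (z x) (t x) := by
  have h : Continuous fun x => z x * (t x : ℂ) ^ 2 := by fun_prop
  exact continuous_cosSqrt.comp h

theorem continuous_sinSol_comp {X : Type*} [TopologicalSpace X] {z : X → ℂ} {t : X → ℝ}
    (hz : Continuous z) (ht : Continuous t) : Continuous fun x => sinSol (z x) (t x) := by
  have h : Continuous fun x => z x * (t x : ℂ) ^ 2 := by fun_prop
  exact (Complex.continuous_ofReal.comp ht).mul (continuous_sincSqrt.comp h)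

theorem hasDerivAt_cosSol (z : ℂ) (t : ℝ) : HasDerivAt (cosSol z) (-z * sinSol z t) t := by
  -- Every `z` is a square `k²`, which turns the power series into `cos (k t)`; no termwise
  -- differentiation is needed.
  obtain ⟨k, rfl⟩ := IsAlgClosed.exists_pow_nat_eq z (n := 2) (by norm_num)
  have h1 : HasDerivAt (fun w : ℂ => k * w) k t := by
    simpa using (hasDerivAt_id (t : ℂ)).const_mul k
  have h2 := h1.ccos.comp_ofReal
  rw [show cosSol (k ^ 2) = fun t : ℝ => Complex.cos (k * t) from funext fun t => cosSol_sq k t]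
  convert! h2 using 1
  rw [← mul_sinSol_sq]
  ring

theorem hasDerivAt_sinSol (z : ℂ) (t : ℝ) : HasDerivAt (sinSol z) (cosSol z t) t := by
  obtain ⟨k, rfl⟩ := IsAlgClosed.exists_pow_nat_eq z (n := 2) (by norm_num)
  by_cases hk : k = 0
  · subst hk
    rw [show sinSol (0 ^ 2) = fun t : ℝ => (t : ℂ) from
      funext fun t => by simp [sinSol_zero_left], show (0 : ℂ) ^ 2 = 0 by simp, cosSol_zero_left]
    exact Complex.ofRealCLM.hasDerivAt
  have h1 : HasDerivAt (fun w : ℂ => k * w) k t := by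
    simpa using (hasDerivAt_id (t : ℂ)).const_mul k
  have h2 := (h1.csin.const_mul k⁻¹).comp_ofReal
  rw [show sinSol (k ^ 2) = fun t : ℝ => k⁻¹ * Complex.sin (k * t) from
    funext fun t => by rw [← mul_sinSol_sq]; field_simp]
  convert! h2 using 1
  rw [cosSol_sq]
  field_simp

theorem cosSol_sq_add (z : ℂ) (t : ℝ) : cosSol z t ^ 2 + z * sinSol z t ^ 2 = 1 := by
  obtain ⟨k, rfl⟩ := IsAlgClosed.exists_pow_nat_eq z (n := 2) (by norm_num)
  rw [← mul_pow, mul_sinSol_sq, cosSol_sq, add_comm, Complex.sin_sq_add_cos_sq]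

theorem cosSol_neg_sq (s t : ℝ) : cosSol (-(s : ℂ) ^ 2) t = Real.cosh (s * t) := by
  have h := cosSol_sq (s * Complex.I) t
  rw [mul_pow, Complex.I_sq, mul_neg_one] at h
  rw [h, Complex.ofReal_cosh, ← Complex.cos_mul_I]
  congr 1
  push_cast
  ring

theorem mul_sinSol_neg_sq (s t : ℝ) : (s : ℂ) * sinSol (-(s : ℂ) ^ 2) t = Real.sinh (s * t) := by
  have h := mul_sinSol_sq (s * Complex.I) t
  rw [mul_pow, Complex.I_sq, mul_neg_one] at h
  have h2 : Complex.sin (s * Complex.I * t) = Complex.sinh (s * t) * Complex.I := by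
    rw [← Complex.sin_mul_I]
    congr 1
    ring
  rw [h2] at h
  rw [Complex.ofReal_sinh]
  refine mul_right_cancel₀ Complex.I_ne_zero ?_
  push_cast
  rw [← h]
  ring

/-! ### Entire functions: growth, quotients, zeros of determinants. -/

/-- An entire function that grows at most polynomially up to a power of the distance to the real
axis is a polynomial. -/
theorem exists_polynomial_of_norm_mul_im_pow_le {F : ℂ → ℂ} (hF : Differentiable ℂ F) {k M : ℕ}
    (hk : k ≠ 0) {K : ℝ} (hb : ∀ z, ‖F z‖ * |z.im| ^ k ≤ K * (1 + ‖z‖) ^ M) :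
    ∃ p : Polynomial ℂ, ∀ z, F z = p.eval z := by
  have hK : 0 ≤ K := by
    have := hb 0
    simp [hk] at this
    exact this
  have hgrow : ∀ r : ℝ, 1 ≤ r → ∀ z ∈ Metric.sphere (0 : ℂ) r,
      ‖F z‖ ≤ K * 2 ^ k * (3 * r) ^ M := by
    intro r hr z hz
    have hzr : ‖z‖ = r := by simpa using hz
    -- On the circle of radius `2r` the multiplier has modulus `(4r |Im w|)^k`, so it absorbs the
    -- blow-up allowed near the real axis. The maximum principle then gives a bound on the circle of
    -- radius `r`, where the multiplier has modulus at least `(3r²)^k ≥ (2r)^k`.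
    have hmax := Complex.norm_le_of_forall_mem_frontier_norm_le (U := Metric.ball (0 : ℂ) (2 * r))
      (f := fun w => F w * (w ^ 2 - ((2 * r : ℝ) : ℂ) ^ 2) ^ k)
      (C := K * (1 + 2 * r) ^ M * (2 * (2 * r)) ^ k) Metric.isBounded_ball
      (Differentiable.diffContOnCl (by fun_prop)) ?_ (z := z) ?_
    · simp only [norm_mul, norm_pow] at hmax
      have h1 : 3 * r ^ 2 ≤ ‖z ^ 2 - ((2 * r : ℝ) : ℂ) ^ 2‖ := by
        have h2 := norm_sub_norm_le (((2 * r : ℝ) : ℂ) ^ 2) (z ^ 2)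
        rw [norm_sub_rev] at h2
        rw [norm_pow, norm_pow, hzr, Complex.norm_real, Real.norm_of_nonneg (by linarith)] at h2
        linarith
      have h3 : (2 * r) ^ k ≤ ‖z ^ 2 - ((2 * r : ℝ) : ℂ) ^ 2‖ ^ k := by
        refine pow_le_pow_left₀ (by linarith) (le_trans ?_ h1) k
        nlinarith
      have h4 : ‖F z‖ * (2 * r) ^ k ≤ K * (1 + 2 * r) ^ M * (2 * (2 * r)) ^ k :=
        le_trans (by gcongr) hmax
      rw [mul_pow 2 (2 * r), ← mul_assoc] at h4
      have h5 := le_of_mul_le_mul_right h4 (by positivity)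
      refine h5.trans ?_
      rw [mul_right_comm]
      gcongr
      linarith
    · intro w hw
      rw [frontier_ball _ (by linarith)] at hw
      have hwr : ‖w‖ = 2 * r := by simpa using hw
      have h1 : ‖w ^ 2 - ((2 * r : ℝ) : ℂ) ^ 2‖ = 2 * (2 * r) * |w.im| := by
        -- `w² - ‖w‖² = w (w - conj w)`, and the second factor is `2i Im w`.
        rw [← hwr, ← Complex.mul_conj', pow_two, ← mul_sub, Complex.sub_conj]
        simp
        ring
      rw [norm_mul, norm_pow, h1, mul_pow, ← hwr]
      calc _ = (‖F w‖ * |w.im| ^ k) * (2 * ‖w‖) ^ k := by ring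
        _ ≤ _ := mul_le_mul_of_nonneg_right (hb w) (by positivity)
    · refine subset_closure ?_
      simp [hzr]
      linarith
  -- Cauchy's estimates on growing circles kill the Taylor coefficients beyond degree `M`.
  have hder : ∀ j, M < j → iteratedDeriv j F 0 = 0 := by
    intro j hj
    rw [← norm_le_zero_iff]
    have hlim : Tendsto (fun r : ℝ => j.factorial * (K * 2 ^ k * 3 ^ M) / r ^ (j - M)) atTop
        (𝓝 0) :=
      tendsto_const_nhds.div_atTop (tendsto_pow_atTop (by lia))
    refine ge_of_tendsto hlim ?_
    filter_upwards [eventually_ge_atTop 1] with r hr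
    have h1 := Complex.norm_iteratedDeriv_le_of_forall_mem_sphere_norm_le j (c := 0)
      (R := r) (by linarith) hF.diffContOnCl (hgrow r hr)
    refine h1.trans (le_of_eq ?_)
    have hr0 : r ≠ 0 := by linarith
    rw [mul_pow, div_eq_div_iff (by positivity) (by positivity),
      show r ^ j = r ^ (j - M) * r ^ M by rw [← pow_add]; congr 1; lia]
    ring
  refine ⟨∑ j ∈ Finset.range (M + 1),
    Polynomial.C ((j.factorial : ℂ)⁻¹ * iteratedDeriv j F 0) * Polynomial.X ^ j, fun z => ?_⟩
  have h := Complex.taylorSeries_eq_of_entire' (c := 0) (z := z) hF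
  rw [← h, tsum_eq_sum (s := Finset.range (M + 1)), Polynomial.eval_finsetSum]
  · simp
  · intro j hj
    rw [hder j (by simpa using hj)]
    simp

/-- The quotient of two entire functions with the same zeros, counted with multiplicity, is
entire. -/
theorem exists_entire_mul_eq {g h : ℂ → ℂ} (hg : Differentiable ℂ g) (hh : Differentiable ℂ h)
    (hord : ∀ z, analyticOrderAt g z = analyticOrderAt h z)
    (hfin : ∀ z, analyticOrderAt h z ≠ ⊤) :
    ∃ F : ℂ → ℂ, Differentiable ℂ F ∧ ∀ z, g z = F z * h z := by
  have hga : ∀ z, AnalyticAt ℂ g z := fun z => hg.analyticAt z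
  have hha : ∀ z, AnalyticAt ℂ h z := fun z => hh.analyticAt z
  have hm : MeromorphicOn (g / h) univ := fun z _ =>
    (hga z).meromorphicAt.div (hha z).meromorphicAt
  -- Equal finite orders make the order of the quotient zero everywhere; passing to the normal form
  -- fills in the removable singularities.
  have hFa : ∀ z, AnalyticAt ℂ (toMeromorphicNFOn (g / h) univ) z := by
    intro z
    rw [← (meromorphicNFOn_toMeromorphicNFOn (g / h) univ
      (mem_univ z)).meromorphicOrderAt_nonneg_iff_analyticAt,
      meromorphicOrderAt_toMeromorphicNFOn hm (mem_univ z),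
      meromorphicOrderAt_div (hga z).meromorphicAt (hha z).meromorphicAt,
      (hga z).meromorphicOrderAt_eq, (hha z).meromorphicOrderAt_eq, hord z]
    obtain ⟨m, hm⟩ := ENat.ne_top_iff_exists.1 (hfin z)
    rw [← hm]
    simp
  refine ⟨_, fun z => (hFa z).differentiableAt, fun z => ?_⟩
  have h1 : ∀ᶠ w in 𝓝[≠] z, g w = toMeromorphicNFOn (g / h) univ w * h w := by
    have h2 := hm.toMeromorphicNFOn_eq_self_on_nhdsNE (mem_univ z)
    have h3 : ∀ᶠ w in 𝓝[≠] z, h w ≠ 0 := by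
      refine (hha z).eventually_eq_zero_or_eventually_ne_zero.resolve_left fun h0 => ?_
      exact hfin z (analyticOrderAt_eq_top.2 h0)
    filter_upwards [h2, h3] with w hw hw0
    rw [hw, Pi.div_apply, div_mul_cancel₀ _ hw0]
  exact (((hga z).continuousAt.eventuallyEq_nhds_iff_eventuallyEq_nhdsNE
    ((hFa z).continuousAt.mul (hha z).continuousAt)).1 h1).self_of_nhds

/-- Every subspace of `ι → ℂ` is spanned by a part of a basis indexed by `ι`, the rest of which
spans a complement. -/
theorem exists_basis_of_submodule {ι : Type*} [Fintype ι] (K : Submodule ℂ (ι → ℂ)) :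
    ∃ (b : Module.Basis ι ℂ (ι → ℂ)) (s : Finset ι) (W : Submodule ℂ (ι → ℂ)), Disjoint K W ∧
      (∀ i ∈ s, b i ∈ K) ∧ (∀ i ∉ s, b i ∈ W) ∧ s.card = Module.finrank ℂ K := by
  classical
  obtain ⟨W, hW⟩ := K.exists_isCompl
  let b₀ := ((Module.finBasis ℂ K).prod (Module.finBasis ℂ W)).map
    (Submodule.prodEquivOfIsCompl K W hW)
  let e := b₀.indexEquiv (Pi.basisFun ℂ ι)
  refine ⟨b₀.reindex e, (Finset.univ.map ⟨Sum.inl, Sum.inl_injective⟩).map e.toEmbedding, W,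
    hW.disjoint, ?_, ?_, ?_⟩
  · intro i hi
    simp only [Finset.mem_map, Finset.mem_univ, true_and] at hi
    obtain ⟨_, ⟨j, rfl⟩, rfl⟩ := hi
    simp [b₀]
  · intro i hi
    obtain ⟨j, rfl⟩ := e.surjective i
    rcases j with j | j
    · simp at hi
    · simp [b₀]
  · simp

/-- The order of a zero of the determinant of an entire matrix function is the dimension of its
kernel, if there are no Jordan chains of length two. -/
theorem analyticOrderAt_det_eq_finrank_ker {ι : Type*} [Fintype ι] [DecidableEq ι]
    {T : ℂ → Matrix ι ι ℂ} (hT : ∀ i j, Differentiable ℂ fun z => T z i j) (z₀ : ℂ)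
    (hJ : ∀ v w : ι → ℂ, T z₀ *ᵥ v = 0 →
      HasDerivAt (fun z => T z *ᵥ (v + (z - z₀) • w)) 0 z₀ → v = 0) :
    analyticOrderAt (fun z => (T z).det) z₀ =
      (Module.finrank ℂ (LinearMap.ker (Matrix.toLin' (T z₀))) : ℕ∞) := by
  obtain ⟨b, s, W, hdisj, hs, hsc, hcard⟩ :=
    exists_basis_of_submodule (LinearMap.ker (Matrix.toLin' (T z₀)))
  rw [← hcard]
  have hdiff : ∀ v : ι → ℂ, Differentiable ℂ fun z => T z *ᵥ v := by
    intro v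
    rw [differentiable_pi]
    intro i
    simp only [Matrix.mulVec, dotProduct]
    exact Differentiable.fun_sum fun j _ => (hT i j).mul_const _
  have hker : ∀ i ∈ s, T z₀ *ᵥ b i = 0 := fun i hi => by simpa using hs i hi
  -- In a basis adapted to the kernel, the columns `T z *ᵥ b i` with `i ∈ s` vanish at `z₀`, and `U`
  -- divides them by `z - z₀`. So `det T` is `(z - z₀) ^ s.card` times a constant multiple of `det
  -- U`.
  let U : ℂ → Matrix ι ι ℂ := fun z => Matrix.of fun j i =>
    if i ∈ s then dslope (fun z => T z *ᵥ b i) z₀ z j else (T z *ᵥ b i) j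
  let P : Matrix ι ι ℂ := Matrix.of fun j i => b i j
  have hTP : ∀ z, T z * P = U z * Matrix.diagonal fun i => if i ∈ s then z - z₀ else 1 := by
    intro z
    ext j i
    rw [Matrix.mul_diagonal]
    have h1 : (T z * P) j i = (T z *ᵥ b i) j := rfl
    rw [h1]
    simp only [U, Matrix.of_apply]
    split_ifs with h
    · have h2 := congrFun (sub_smul_dslope (fun z => T z *ᵥ b i) z₀ z) j
      simp only [hker i h, sub_zero, Pi.smul_apply, smul_eq_mul] at h2
      rw [mul_comm, h2]
    · simp
  have hP : P.det ≠ 0 := by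
    have h1 : P = (Pi.basisFun ℂ ι).toMatrix b := by
      ext i j
      simp [P, Module.Basis.toMatrix_apply]
    rw [h1, ← Module.Basis.det_apply]
    exact (Module.Basis.isUnit_det _ b).ne_zero
  have hUdet : Differentiable ℂ fun z => (U z).det := by
    have hU : ∀ j i, Differentiable ℂ fun z => U z j i := by
      intro j i
      simp only [U, Matrix.of_apply]
      split_ifs with h
      · have h1 : Differentiable ℂ (dslope (fun z => T z *ᵥ b i) z₀) := by
          rw [← differentiableOn_univ]
          exact (Complex.differentiableOn_dslope univ_mem).2 (hdiff _).differentiableOn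
        exact differentiable_pi.1 h1 j
      · exact differentiable_pi.1 (hdiff _) j
    simp only [Matrix.det_apply]
    exact Differentiable.fun_sum fun σ _ =>
      (Differentiable.fun_finsetProd fun i _ => hU _ _).const_smul _
  -- A kernel vector of `U z₀` splits into `v` in the kernel of `T z₀` and `w` in the complement
  -- with `T'(z₀) v + T(z₀) w = 0`, a Jordan chain. Hence `v = 0`, and then `w` lies in both the
  -- kernel and its complement.
  have hU0 : (U z₀).det ≠ 0 := by
    intro h0
    obtain ⟨x, hx0, hx⟩ := Matrix.exists_mulVec_eq_zero_iff.2 h0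
    refine hx0 ?_
    set v : ι → ℂ := ∑ i ∈ s, x i • b i with hv
    set w : ι → ℂ := ∑ i ∈ sᶜ, x i • b i with hw
    have hTv : T z₀ *ᵥ v = 0 := by
      rw [hv, Matrix.mulVec_sum]
      refine Finset.sum_eq_zero fun i hi => ?_
      rw [Matrix.mulVec_smul, hker i hi, smul_zero]
    have hder : HasDerivAt (fun z => T z *ᵥ v) (∑ i ∈ s, x i • deriv (fun z => T z *ᵥ b i) z₀)
        z₀ := by
      have h1 : (fun z => T z *ᵥ v) = fun z => ∑ i ∈ s, x i • T z *ᵥ b i := by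
        funext z
        rw [hv, Matrix.mulVec_sum]
        simp only [Matrix.mulVec_smul]
      rw [h1]
      exact HasDerivAt.fun_sum fun i _ => ((hdiff (b i)) z₀).hasDerivAt.fun_const_smul _
    have hsum : (∑ i ∈ s, x i • deriv (fun z => T z *ᵥ b i) z₀) + T z₀ *ᵥ w = 0 := by
      rw [hw, Matrix.mulVec_sum, ← hx]
      funext j
      simp only [Matrix.mulVec_smul, Pi.add_apply, Finset.sum_apply, Pi.smul_apply, smul_eq_mul]
      rw [Matrix.mulVec, dotProduct, ← Finset.sum_add_sum_compl s]
      congr 1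
      · refine Finset.sum_congr rfl fun i hi => ?_
        simp [U, hi, mul_comm]
      · refine Finset.sum_congr rfl fun i hi => ?_
        simp [U, Finset.mem_compl.1 hi, mul_comm]
    have hv0 : v = 0 := by
      refine hJ v w hTv ?_
      have h2 : HasDerivAt (fun z => (z - z₀) • T z *ᵥ w)
          ((z₀ - z₀) • deriv (fun z => T z *ᵥ w) z₀ + (1 : ℂ) • T z₀ *ᵥ w) z₀ :=
        ((hasDerivAt_id z₀).sub_const z₀).fun_smul (hdiff w z₀).hasDerivAt
      have h3 := hder.fun_add h2
      simp only [sub_self, zero_smul, zero_add, one_smul, hsum] at h3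
      simpa only [Matrix.mulVec_add, Matrix.mulVec_smul] using h3
    have hTw : T z₀ *ᵥ w = 0 := by
      have h1 : (fun z => T z *ᵥ v) = fun _ => 0 := by
        funext z
        rw [hv0, Matrix.mulVec_zero]
      rw [h1] at hder
      rw [hder.unique (hasDerivAt_const z₀ (0 : ι → ℂ)), zero_add] at hsum
      exact hsum
    have hwW : w ∈ W := Submodule.sum_mem _ fun i hi =>
      W.smul_mem _ (hsc i (Finset.mem_compl.1 hi))
    have hw0 : w = 0 := by
      have := Submodule.disjoint_def.1 hdisj w (by simpa using hTw) hwW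
      exact this
    have htot : ∑ i, x i • b i = 0 := by
      rw [← Finset.sum_add_sum_compl s, ← hv, ← hw, hv0, hw0, add_zero]
    funext i
    exact Fintype.linearIndependent_iff.1 b.linearIndependent x htot i
  have hdet : ∀ z, (T z).det = (z - z₀) ^ s.card • ((P.det)⁻¹ * (U z).det) := by
    intro z
    have h1 := congrArg Matrix.det (hTP z)
    rw [Matrix.det_mul, Matrix.det_mul, Matrix.det_diagonal, Finset.prod_ite_mem,
      Finset.univ_inter, Finset.prod_const] at h1
    rw [eq_div_of_mul_eq hP h1, smul_eq_mul]
    ring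
  have hTan : AnalyticAt ℂ (fun z => (T z).det) z₀ := by
    have : Differentiable ℂ fun z => (T z).det := by
      simp only [hdet]
      fun_prop
    exact this.analyticAt z₀
  rw [hTan.analyticOrderAt_eq_natCast]
  exact ⟨fun z => (P.det)⁻¹ * (U z).det, (hUdet.const_mul _).analyticAt z₀,
    mul_ne_zero (inv_ne_zero hP) hU0, Eventually.of_forall hdet⟩

/-! ### Green's identity and the characteristic matrix. -/

/-- Green's identity for solutions of `-f'' = z f` and `-g'' = w g` on an interval. -/
theorem green_interval {a b : ℝ} {f f' g g' : ℝ → ℂ} {z w : ℂ}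
    (hf : ∀ x, HasDerivAt f (f' x) x) (hf' : ∀ x, HasDerivAt f' (-z * f x) x)
    (hg : ∀ x, HasDerivAt g (g' x) x) (hg' : ∀ x, HasDerivAt g' (-w * g x) x) :
    (z - conj w) * ∫ x in a..b, f x * conj (g x) =
      (f' a * conj (g a) - f a * conj (g' a)) - (f' b * conj (g b) - f b * conj (g' b)) := by
  have hfc : Continuous f := continuous_iff_continuousAt.2 fun x => (hf x).continuousAt
  have hgc : Continuous g := continuous_iff_continuousAt.2 fun x => (hg x).continuousAt
  have h1 : ∀ x ∈ uIcc a b, HasDerivAt (fun x => f x * conj (g' x) - f' x * conj (g x))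
      ((z - conj w) * (f x * conj (g x))) x := by
    intro x _
    have := ((hf x).fun_mul (hg' x).star).fun_sub ((hf' x).fun_mul (hg x).star)
    refine this.congr_deriv ?_
    simp only [starRingEnd_apply, star_mul', star_neg]
    ring
  have h2 := intervalIntegral.integral_eq_sub_of_hasDerivAt h1
    (Continuous.intervalIntegrable (by fun_prop) _ _)
  rw [intervalIntegral.integral_const_mul] at h2
  rw [h2]
  ring

namespace MetricGraph

variable (Γ : MetricGraph n N)

/-- The function that solves `-f'' = z f` on every edge and whose value and derivative at the left
endpoint of the edge `j` are `c (j, false)` and `c (j, true)`. -/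
def sol (z : ℂ) (c : Fin n × Bool → ℂ) (j : Fin n) (x : ℝ) : ℂ :=
  c (j, false) * cosSol z (x - Γ.left j) + c (j, true) * sinSol z (x - Γ.left j)

/-- The derivative of `sol`. -/
def solDeriv (z : ℂ) (c : Fin n × Bool → ℂ) (j : Fin n) (x : ℝ) : ℂ :=
  c (j, false) * (-z * sinSol z (x - Γ.left j)) + c (j, true) * cosSol z (x - Γ.left j)

theorem hasDerivAt_sol (z : ℂ) (c : Fin n × Bool → ℂ) (j : Fin n) (x : ℝ) :
    HasDerivAt (Γ.sol z c j) (Γ.solDeriv z c j x) x :=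
  (((hasDerivAt_cosSol z _).comp_sub_const x (Γ.left j)).const_mul _).add
    (((hasDerivAt_sinSol z _).comp_sub_const x (Γ.left j)).const_mul _)

theorem hasDerivAt_solDeriv (z : ℂ) (c : Fin n × Bool → ℂ) (j : Fin n) (x : ℝ) :
    HasDerivAt (Γ.solDeriv z c j) (-z * Γ.sol z c j x) x := by
  refine (((((hasDerivAt_sinSol z _).comp_sub_const x (Γ.left j)).const_mul (-z)).const_mul
    _).add (((hasDerivAt_cosSol z _).comp_sub_const x (Γ.left j)).const_mul _)).congr_deriv ?_
  rw [sol]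
  ring

theorem continuous_sol (z : ℂ) (c : Fin n × Bool → ℂ) (j : Fin n) : Continuous (Γ.sol z c j) :=
  continuous_iff_continuousAt.2 fun x => (Γ.hasDerivAt_sol z c j x).continuousAt

theorem continuous_solDeriv (z : ℂ) (c : Fin n × Bool → ℂ) (j : Fin n) :
    Continuous (Γ.solDeriv z c j) :=
  continuous_iff_continuousAt.2 fun x => (Γ.hasDerivAt_solDeriv z c j x).continuousAt

theorem sol_left (z : ℂ) (c : Fin n × Bool → ℂ) (j : Fin n) :
    Γ.sol z c j (Γ.left j) = c (j, false) := by
  simp [sol, cosSol_zero_right, sinSol_zero_right]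

theorem solDeriv_left (z : ℂ) (c : Fin n × Bool → ℂ) (j : Fin n) :
    Γ.solDeriv z c j (Γ.left j) = c (j, true) := by
  simp [solDeriv, cosSol_zero_right, sinSol_zero_right]

theorem sol_eq_zero {z : ℂ} {c : Fin n × Bool → ℂ} {j : Fin n}
    (h : ∀ x ∈ Icc (Γ.left j) (Γ.right j), Γ.sol z c j x = 0) (i : Bool) : c (j, i) = 0 := by
  have hlt := Γ.left_lt_right j
  have ha : Γ.left j ∈ Icc (Γ.left j) (Γ.right j) := left_mem_Icc.2 hlt.le
  cases i
  · rw [← Γ.sol_left z c j, h _ ha]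
  · rw [← Γ.solDeriv_left z c j]
    have h1 := (Γ.hasDerivAt_sol z c j (Γ.left j)).hasDerivWithinAt
      (s := Icc (Γ.left j) (Γ.right j))
    have h2 : HasDerivWithinAt (Γ.sol z c j) 0 (Icc (Γ.left j) (Γ.right j)) (Γ.left j) :=
      (hasDerivWithinAt_const _ _ (0 : ℂ)).congr h (h _ ha)
    exact (uniqueDiffOn_Icc hlt _ ha).eq_deriv _ h1 h2

/-- The inner product of two functions on the edges. -/
def pairing (f g : Fin n → ℝ → ℂ) : ℂ :=
  ∑ j, ∫ x in Γ.left j..Γ.right j, f j x * conj (g j x)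

theorem green (z w : ℂ) (c e : Fin n × Bool → ℂ) :
    (z - conj w) * Γ.pairing (Γ.sol z c) (Γ.sol w e) =
      ∑ p, (Γ.normalDeriv (Γ.solDeriv z c) p * conj (Γ.endpointValue (Γ.sol w e) p) -
        Γ.endpointValue (Γ.sol z c) p * conj (Γ.normalDeriv (Γ.solDeriv w e) p)) := by
  rw [pairing, Finset.mul_sum, Fintype.sum_prod_type]
  refine Finset.sum_congr rfl fun j _ => ?_
  rw [green_interval (Γ.hasDerivAt_sol z c j) (Γ.hasDerivAt_solDeriv z c j)
    (Γ.hasDerivAt_sol w e j) (Γ.hasDerivAt_solDeriv w e j), Fintype.sum_bool]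
  simp only [normalDeriv, endpointValue, Bool.false_eq_true, if_true, if_false, map_neg]
  ring

/-- The squared norm of a function on the edges. -/
def normSq (f : Fin n → ℝ → ℂ) : ℝ := ∑ j, ∫ x in Γ.left j..Γ.right j, ‖f j x‖ ^ 2

theorem pairing_self (f : Fin n → ℝ → ℂ) : Γ.pairing f f = Γ.normSq f := by
  rw [pairing, normSq, Complex.ofReal_sum]
  refine Finset.sum_congr rfl fun j _ => ?_
  rw [← intervalIntegral.integral_ofReal]
  simp only [Complex.mul_conj', Complex.ofReal_pow]

theorem integral_norm_sq_nonneg (f : Fin n → ℝ → ℂ) (j : Fin n) :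
    0 ≤ ∫ x in Γ.left j..Γ.right j, ‖f j x‖ ^ 2 :=
  intervalIntegral.integral_nonneg (Γ.left_lt_right j).le fun _ _ => by positivity

theorem sol_eq_zero_of_normSq_eq_zero {z : ℂ} {c : Fin n × Bool → ℂ}
    (h : Γ.normSq (Γ.sol z c) = 0) : c = 0 := by
  funext ⟨j, i⟩
  refine Γ.sol_eq_zero (z := z) (fun x hx => ?_) i
  have h1 := (Finset.sum_eq_zero_iff_of_nonneg
    fun j _ => Γ.integral_norm_sq_nonneg (Γ.sol z c) j).1 h j (Finset.mem_univ j)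
  by_contra hne
  have hc := Γ.continuous_sol z c j
  refine (intervalIntegral.integral_pos (Γ.left_lt_right j) (f := fun x => ‖Γ.sol z c j x‖ ^ 2)
    (by fun_prop) (fun _ _ => by positivity) ⟨x, hx, ?_⟩).ne' h1
  have := norm_pos_iff.2 hne
  positivity

/-- The endpoint values of `sol`, as a linear map in the coefficients. -/
def solValueMap (z : ℂ) : (Fin n × Bool → ℂ) →ₗ[ℂ] (Fin n × Bool → ℂ) where
  toFun c := Γ.endpointValue (Γ.sol z c)
  map_add' c d := by
    funext p
    simp only [endpointValue, sol, Pi.add_apply]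
    split_ifs <;> ring
  map_smul' a c := by
    funext p
    simp only [endpointValue, sol, Pi.smul_apply, smul_eq_mul, RingHom.id_apply]
    split_ifs <;> ring

/-- The normal derivatives of `sol` at the endpoints, as a linear map in the coefficients. -/
def solNormalDerivMap (z : ℂ) : (Fin n × Bool → ℂ) →ₗ[ℂ] (Fin n × Bool → ℂ) where
  toFun c := Γ.normalDeriv (Γ.solDeriv z c)
  map_add' c d := by
    funext p
    simp only [normalDeriv, solDeriv, Pi.add_apply]
    split_ifs <;> ring
  map_smul' a c := by
    funext p
    simp only [normalDeriv, solDeriv, Pi.smul_apply, smul_eq_mul, RingHom.id_apply]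
    split_ifs <;> ring

/-- The incidence matrix of endpoints and vertices. -/
def incidence : Matrix (Fin n × Bool) (Fin N) ℂ :=
  Matrix.of fun p v => if Γ.vertexOf p = v then 1 else 0

theorem incidence_mulVec (d : Fin N → ℂ) (p : Fin n × Bool) :
    (Γ.incidence *ᵥ d) p = d (Γ.vertexOf p) := by
  simp [incidence, Matrix.mulVec, dotProduct]

theorem incidence_transpose_mulVec (h : Fin n × Bool → ℂ) (v : Fin N) :
    (Γ.incidenceᵀ *ᵥ h) v = ∑ p ∈ Γ.endpointsAt v, h p := by
  simp [incidence, Matrix.mulVec, dotProduct, endpointsAt, Finset.sum_filter]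

/-- The matrix of the linear system that the coefficients of an eigenfunction and the values of
its normal derivative at the vertices satisfy. -/
def charMatrix (α : Fin N → ℝ) (z : ℂ) :
    Matrix ((Fin n × Bool) ⊕ Fin N) ((Fin n × Bool) ⊕ Fin N) ℂ :=
  Matrix.fromBlocks (LinearMap.toMatrix' (Γ.solNormalDerivMap z)) (-Γ.incidence)
    (Γ.incidenceᵀ * LinearMap.toMatrix' (Γ.solValueMap z))
    (-Matrix.diagonal fun v => (α v : ℂ))

theorem charMatrix_mulVec_inl (α : Fin N → ℝ) (z : ℂ) (x : (Fin n × Bool) ⊕ Fin N → ℂ)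
    (p : Fin n × Bool) : (Γ.charMatrix α z *ᵥ x) (Sum.inl p) =
      Γ.normalDeriv (Γ.solDeriv z (x ∘ Sum.inl)) p - x (Sum.inr (Γ.vertexOf p)) := by
  rw [charMatrix, Matrix.fromBlocks_mulVec, Sum.elim_inl, Pi.add_apply,
    LinearMap.toMatrix'_mulVec, Matrix.neg_mulVec, Pi.neg_apply, incidence_mulVec, sub_eq_add_neg]
  rfl

theorem charMatrix_mulVec_inr (α : Fin N → ℝ) (z : ℂ) (x : (Fin n × Bool) ⊕ Fin N → ℂ)
    (v : Fin N) : (Γ.charMatrix α z *ᵥ x) (Sum.inr v) =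
      ∑ p ∈ Γ.endpointsAt v, Γ.endpointValue (Γ.sol z (x ∘ Sum.inl)) p -
        α v * x (Sum.inr v) := by
  rw [charMatrix, Matrix.fromBlocks_mulVec, Sum.elim_inr, Pi.add_apply, ← Matrix.mulVec_mulVec,
    LinearMap.toMatrix'_mulVec, Matrix.neg_mulVec, Pi.neg_apply, incidence_transpose_mulVec,
    Matrix.mulVec_diagonal, sub_eq_add_neg]
  rfl

theorem differentiable_charMatrix (α : Fin N → ℝ) (i k : (Fin n × Bool) ⊕ Fin N) :
    Differentiable ℂ fun z => Γ.charMatrix α z i k := by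
  have hc : ∀ t, Differentiable ℂ fun z => cosSol z t := differentiable_cosSol
  have hs : ∀ t, Differentiable ℂ fun z => sinSol z t := differentiable_sinSol
  rcases i with p | v <;> rcases k with q | w
  · simp only [charMatrix, Matrix.fromBlocks_apply₁₁, LinearMap.toMatrix'_apply,
      solNormalDerivMap, LinearMap.coe_mk, AddHom.coe_mk, normalDeriv, solDeriv]
    split_ifs <;> fun_prop
  · simp [charMatrix]
  · simp only [charMatrix, Matrix.fromBlocks_apply₂₁, Matrix.mul_apply, LinearMap.toMatrix'_apply,
      solValueMap, LinearMap.coe_mk, AddHom.coe_mk, endpointValue, sol]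
    refine Differentiable.fun_sum fun r _ => Differentiable.const_mul ?_ _
    split_ifs <;> fun_prop
  · simp [charMatrix]

/-- Green's identity, in terms of the residuals in the linear system for eigenfunctions. -/
theorem green_charMatrix (α : Fin N → ℝ) (z w : ℂ) (x y : (Fin n × Bool) ⊕ Fin N → ℂ) :
    (z - conj w) * Γ.pairing (Γ.sol z (x ∘ Sum.inl)) (Γ.sol w (y ∘ Sum.inl)) =
      ∑ p, ((Γ.charMatrix α z *ᵥ x) (Sum.inl p) *
          conj (Γ.endpointValue (Γ.sol w (y ∘ Sum.inl)) p) -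
        Γ.endpointValue (Γ.sol z (x ∘ Sum.inl)) p *
          conj ((Γ.charMatrix α w *ᵥ y) (Sum.inl p))) +
      ∑ v, (x (Sum.inr v) * conj ((Γ.charMatrix α w *ᵥ y) (Sum.inr v)) -
        (Γ.charMatrix α z *ᵥ x) (Sum.inr v) * conj (y (Sum.inr v))) := by
  rw [green]
  have hv : ∀ g : Fin n × Bool → ℂ, ∑ p, g p = ∑ v, ∑ p ∈ Γ.endpointsAt v, g p := fun g =>
    (Finset.sum_fiberwise _ Γ.vertexOf g).symm
  -- The coupling terms cancel because `α v` is real; only boundary values at the endpoints of `v`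
  -- remain.
  have h1 : ∀ v, x (Sum.inr v) * conj ((Γ.charMatrix α w *ᵥ y) (Sum.inr v)) -
      (Γ.charMatrix α z *ᵥ x) (Sum.inr v) * conj (y (Sum.inr v)) =
      ∑ p ∈ Γ.endpointsAt v, (x (Sum.inr (Γ.vertexOf p)) *
        conj (Γ.endpointValue (Γ.sol w (y ∘ Sum.inl)) p) -
        Γ.endpointValue (Γ.sol z (x ∘ Sum.inl)) p * conj (y (Sum.inr (Γ.vertexOf p)))) := by
    intro v
    have h2 : ∀ p ∈ Γ.endpointsAt v, Γ.vertexOf p = v := fun p hp => (Finset.mem_filter.1 hp).2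
    rw [Finset.sum_congr rfl fun p hp => by rw [h2 p hp], Finset.sum_sub_distrib,
      ← Finset.mul_sum, ← Finset.sum_mul, charMatrix_mulVec_inr, charMatrix_mulVec_inr,
      map_sub, map_sum, map_mul, Complex.conj_ofReal]
    ring
  rw [Finset.sum_congr rfl fun v _ => h1 v, ← hv, ← Finset.sum_add_distrib]
  refine Finset.sum_congr rfl fun p _ => ?_
  rw [charMatrix_mulVec_inl, charMatrix_mulVec_inl, map_sub]
  ring

/-- Every vertex contains an endpoint, so the vertex unknowns are normal derivatives of the solution
and carry no extra freedom. -/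
theorem eq_zero_of_charMatrix_mulVec_eq_zero {α : Fin N → ℝ} {z : ℂ}
    {x : (Fin n × Bool) ⊕ Fin N → ℂ} (hx : Γ.charMatrix α z *ᵥ x = 0)
    (h0 : x ∘ Sum.inl = 0) : x = 0 := by
  funext i
  rcases i with p | v
  · exact congrFun h0 p
  · obtain ⟨p, rfl⟩ := Γ.vertexOf_surjective v
    have h1 := congrFun hx (Sum.inl p)
    rw [charMatrix_mulVec_inl, h0, Pi.zero_apply, sub_eq_zero] at h1
    rw [← h1]
    exact congrFun (Γ.solNormalDerivMap z).map_zero p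

/-- Continuity of `P` suffices, which spares differentiating the pairing with respect to the
spectral parameter. -/
theorem eq_zero_of_hasDerivAt_sub_mul {P : ℂ → ℂ} {z₀ : ℂ} (hc : Continuous P)
    (h : HasDerivAt (fun z => (z - z₀) * P z) 0 z₀) : P z₀ = 0 := by
  have h1 : HasDerivAt (fun z => (z - z₀) * P z) (P z₀) z₀ := by
    rw [hasDerivAt_iff_tendsto_slope]
    refine (hc.tendsto z₀).mono_left nhdsWithin_le_nhds |>.congr' ?_
    filter_upwards [self_mem_nhdsWithin] with z hz
    have : z - z₀ ≠ 0 := sub_ne_zero.2 hz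
    simp [slope, this]
  exact h1.unique h

theorem continuous_pairing_sol (z₀ : ℂ) (c e : Fin n × Bool → ℂ) {g : Fin n → ℝ → ℂ}
    (hg : ∀ j, Continuous (g j)) :
    Continuous fun z => Γ.pairing (Γ.sol z (c + (z - z₀) • e)) g := by
  have hj : ∀ j, Continuous fun q : ℂ × ℝ =>
      Γ.sol q.1 (c + (q.1 - z₀) • e) j q.2 * conj (g j q.2) := by
    intro j
    have h0 : Continuous fun q : ℂ × ℝ => conj (g j q.2) :=
      Complex.continuous_conj.comp ((hg j).comp continuous_snd)
    have h1 : Continuous fun q : ℂ × ℝ => cosSol q.1 (q.2 - Γ.left j) :=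
      continuous_cosSol_comp continuous_fst (continuous_snd.sub continuous_const)
    have h2 : Continuous fun q : ℂ × ℝ => sinSol q.1 (q.2 - Γ.left j) :=
      continuous_sinSol_comp continuous_fst (continuous_snd.sub continuous_const)
    have h3 : ∀ i, Continuous fun q : ℂ × ℝ => (c + (q.1 - z₀) • e) (j, i) := by
      intro i
      simp only [Pi.add_apply, Pi.smul_apply, smul_eq_mul]
      fun_prop
    exact (((h3 false).mul h1).add ((h3 true).mul h2)).mul h0
  exact continuous_finsetSum _ fun j _ =>
    intervalIntegral.continuous_parametric_intervalIntegral_of_continuous'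
      (f := fun z x => Γ.sol z (c + (z - z₀) • e) j x * conj (g j x)) (hj j) _ _

/-- The chain is paired with its own eigenfunction: by Green's identity `(z - conj z₀) P z` is a
linear expression in the residual, and `P z₀` is the squared norm. For real `z₀` the residual has
zero derivative, so `P z₀ = 0`; for nonreal `z₀` evaluation at `z₀` already gives this. -/
theorem charMatrix_no_jordan_chain (α : Fin N → ℝ) (z₀ : ℂ)
    (x y : (Fin n × Bool) ⊕ Fin N → ℂ) (hx : Γ.charMatrix α z₀ *ᵥ x = 0)
    (hy : HasDerivAt (fun z => Γ.charMatrix α z *ᵥ (x + (z - z₀) • y)) 0 z₀) : x = 0 := by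
  obtain ⟨P, hP⟩ : ∃ P : ℂ → ℂ, ∀ z, P z =
      Γ.pairing (Γ.sol z ((x ∘ Sum.inl) + (z - z₀) • (y ∘ Sum.inl)))
        (Γ.sol z₀ (x ∘ Sum.inl)) := ⟨_, fun _ => rfl⟩
  have hP0 : P z₀ = Γ.normSq (Γ.sol z₀ (x ∘ Sum.inl)) := by
    rw [← pairing_self, hP, sub_self, zero_smul, add_zero]
  suffices h : P z₀ = 0 by
    rw [h] at hP0
    exact Γ.eq_zero_of_charMatrix_mulVec_eq_zero hx
      (Γ.sol_eq_zero_of_normSq_eq_zero (Complex.ofReal_eq_zero.1 hP0.symm))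
  have hG : ∀ z, (z - conj z₀) * P z =
      ∑ p, (Γ.charMatrix α z *ᵥ (x + (z - z₀) • y)) (Sum.inl p) *
          conj (Γ.endpointValue (Γ.sol z₀ (x ∘ Sum.inl)) p) -
      ∑ v, (Γ.charMatrix α z *ᵥ (x + (z - z₀) • y)) (Sum.inr v) * conj (x (Sum.inr v)) := by
    intro z
    have h1 := Γ.green_charMatrix α z z₀ (x + (z - z₀) • y) x
    rw [hx] at h1
    simp only [Pi.zero_apply, map_zero, mul_zero, sub_zero, zero_sub,
      Finset.sum_neg_distrib, ← sub_eq_add_neg] at h1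
    rw [← h1, hP]
    rfl
  by_cases hz : conj z₀ = z₀
  · refine eq_zero_of_hasDerivAt_sub_mul (z₀ := z₀) ?_ ?_
    · rw [funext hP]
      exact Γ.continuous_pairing_sol z₀ _ _ (Γ.continuous_sol z₀ _)
    · rw [hz] at hG
      rw [funext hG]
      have h1 := fun i => hasDerivAt_pi.1 hy i
      refine ((HasDerivAt.fun_sum fun p _ => (h1 (Sum.inl p)).mul_const _).fun_sub
        (HasDerivAt.fun_sum fun v _ => (h1 (Sum.inr v)).mul_const _)).congr_deriv ?_
      simp
  · have h1 := hG z₀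
    rw [sub_self, zero_smul, add_zero, hx] at h1
    simp only [Pi.zero_apply, zero_mul, Finset.sum_const_zero, sub_self] at h1
    exact (mul_eq_zero.1 h1).resolve_left (sub_ne_zero.2 (Ne.symm hz))

theorem analyticOrderAt_det_charMatrix (α : Fin N → ℝ) (z : ℂ) :
    analyticOrderAt (fun z => (Γ.charMatrix α z).det) z =
      (Module.finrank ℂ (LinearMap.ker (Matrix.toLin' (Γ.charMatrix α z))) : ℕ∞) :=
  analyticOrderAt_det_eq_finrank_ker (Γ.differentiable_charMatrix α) z
    (Γ.charMatrix_no_jordan_chain α z)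

end MetricGraph

/-! ### Eigenspaces as kernels of the characteristic matrix. -/

theorem hasDerivAt_of_eq_primitive {a b : ℝ} {f g : ℝ → ℂ} (hg : ContinuousOn g (Icc a b))
    (h : ∀ x ∈ Icc a b, f x = f a + ∫ t in a..x, g t) {x : ℝ} (hx : x ∈ Ioo a b) :
    HasDerivAt f (g x) x := by
  have hxI := Ioo_subset_Icc_self hx
  have hi : IntervalIntegrable g volume a x := by
    apply ContinuousOn.intervalIntegrable
    rw [uIcc_of_le hxI.1]
    exact hg.mono (Icc_subset_Icc_right hxI.2)
  have h1 := intervalIntegral.integral_hasDerivAt_right hi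
    ((hg.mono Ioo_subset_Icc_self).stronglyMeasurableAtFilter isOpen_Ioo x hx)
    (hg.continuousAt (Icc_mem_nhds hx.1 hx.2))
  refine (h1.const_add (f a)).congr_of_eventuallyEq ?_
  filter_upwards [isOpen_Ioo.mem_nhds hx] with y hy
  exact h y (Ioo_subset_Icc_self hy)

theorem eq_left_of_hasDerivAt_zero {a b : ℝ} {f : ℝ → ℂ} (hf : ContinuousOn f (Icc a b))
    (h : ∀ x ∈ Ioo a b, HasDerivAt f 0 x) {x : ℝ} (hx : x ∈ Icc a b) : f x = f a := by
  have h1 := intervalIntegral.integral_eq_sub_of_hasDerivAt_of_le hx.1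
    (hf.mono (Icc_subset_Icc_right hx.2)) (f' := fun _ => 0)
    (fun y hy => h y ⟨hy.1, hy.2.trans_le hx.2⟩) (by simp)
  rw [intervalIntegral.integral_zero] at h1
  exact (sub_eq_zero.1 h1.symm)

/-- A `W₂²` solution of `-F'' = z F` is a combination of the fundamental solutions. -/
theorem IsSobolev22.eq_fundamental {a b : ℝ} {F F' F'' : ℝ → ℂ} {z : ℂ}
    (h : IsSobolev22 a b F F' F'')
    (hz : ∀ᵐ x ∂(volume.restrict (Icc a b)), F'' x = -z * F x) {x : ℝ} (hx : x ∈ Icc a b) :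
    F x = F a * cosSol z (x - a) + F' a * sinSol z (x - a) ∧
      F' x = F a * (-z * sinSol z (x - a)) + F' a * cosSol z (x - a) := by
  have hF := h.continuousOn
  have hF' := h.continuousOn_deriv
  have hd : ∀ y ∈ Ioo a b, HasDerivAt F (F' y) y := fun y hy =>
    hasDerivAt_of_eq_primitive hF' h.fun_eq hy
  have hd' : ∀ y ∈ Ioo a b, HasDerivAt F' (-z * F y) y := by
    intro y hy
    refine hasDerivAt_of_eq_primitive (g := fun y => -z * F y) (continuousOn_const.mul hF)
      (fun w hw => ?_) hy
    rw [h.deriv_eq w hw]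
    congr 1
    refine intervalIntegral.integral_congr_ae_restrict ?_
    rw [uIoc_of_le hw.1]
    exact ae_restrict_of_ae_restrict_of_subset
      (Ioc_subset_Icc_self.trans (Icc_subset_Icc_right hw.2)) hz
  have hC : ∀ y, HasDerivAt (fun y => cosSol z (y - a)) (-z * sinSol z (y - a)) y := fun y =>
    (hasDerivAt_cosSol z _).comp_sub_const y a
  have hS : ∀ y, HasDerivAt (fun y => sinSol z (y - a)) (cosSol z (y - a)) y := fun y =>
    (hasDerivAt_sinSol z _).comp_sub_const y a
  have hCc : Continuous fun y => cosSol z (y - a) :=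
    continuous_iff_continuousAt.2 fun y => (hC y).continuousAt
  have hSc : Continuous fun y => sinSol z (y - a) :=
    continuous_iff_continuousAt.2 fun y => (hS y).continuousAt
  -- With `C`, `S` the fundamental solutions, `F C - F' S` and `z F S + F' C` have derivative zero,
  -- so they equal `F a` and `F' a`. The system is solved by `C² + z S² = 1`.
  have h1 := eq_left_of_hasDerivAt_zero
    (f := fun y => F y * cosSol z (y - a) - F' y * sinSol z (y - a))
    ((hF.mul hCc.continuousOn).sub (hF'.mul hSc.continuousOn)) (fun y hy =>
      (((hd y hy).fun_mul (hC y)).fun_sub ((hd' y hy).fun_mul (hS y))).congr_deriv (by ring)) hx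
  have h2 := eq_left_of_hasDerivAt_zero
    (f := fun y => z * (F y * sinSol z (y - a)) + F' y * cosSol z (y - a))
    ((continuousOn_const.mul (hF.mul hSc.continuousOn)).add (hF'.mul hCc.continuousOn))
    (fun y hy => ((((hd y hy).fun_mul (hS y)).const_mul z).fun_add
      ((hd' y hy).fun_mul (hC y))).congr_deriv (by ring)) hx
  simp only [sub_self, cosSol_zero_right, sinSol_zero_right, mul_one, mul_zero, sub_zero,
    zero_add] at h1 h2
  have h3 := cosSol_sq_add z (x - a)
  rw [← h1, ← h2]
  constructor
  · linear_combination -F x * h3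
  · linear_combination -F' x * h3

theorem memLp_restrict_Icc_of_continuous {a b : ℝ} {f : ℝ → ℂ} (hf : Continuous f) :
    MemLp f 2 (volume.restrict (Icc a b)) := by
  obtain ⟨C, hC⟩ := isCompact_Icc.exists_bound_of_continuousOn (hf.continuousOn (s := Icc a b))
  refine MemLp.of_bound hf.aestronglyMeasurable C ?_
  filter_upwards [ae_restrict_mem measurableSet_Icc] with x hx using hC x hx

namespace MetricGraph

variable (Γ : MetricGraph n N)

theorem isSobolev22_sol (z : ℂ) (c : Fin n × Bool → ℂ) (j : Fin n) :
    IsSobolev22 (Γ.left j) (Γ.right j) (Γ.sol z c j) (Γ.solDeriv z c j)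
      (fun x => -z * Γ.sol z c j x) where
  memLp := memLp_restrict_Icc_of_continuous (continuous_const.mul (Γ.continuous_sol z c j))
  deriv_eq x _ := by
    rw [intervalIntegral.integral_eq_sub_of_hasDerivAt
      (fun y _ => Γ.hasDerivAt_solDeriv z c j y)
      ((continuous_const.mul (Γ.continuous_sol z c j)).intervalIntegrable _ _)]
    ring
  fun_eq x _ := by
    rw [intervalIntegral.integral_eq_sub_of_hasDerivAt
      (fun y _ => Γ.hasDerivAt_sol z c j y)
      ((Γ.continuous_solDeriv z c j).intervalIntegrable _ _)]
    ring

theorem memLp_sol (z : ℂ) (c : Fin n × Bool → ℂ) (j : Fin n) :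
    MemLp (Γ.sol z c j) 2 (volume.restrict (Icc (Γ.left j) (Γ.right j))) :=
  memLp_restrict_Icc_of_continuous (Γ.continuous_sol z c j)

/-- `sol` as an element of `L₂(Γ)`, linear in the coefficients. -/
def solLp (z : ℂ) : (Fin n × Bool → ℂ) →ₗ[ℂ] Γ.L2 where
  toFun c := WithLp.toLp 2 fun j => (Γ.memLp_sol z c j).toLp (Γ.sol z c j)
  map_add' c d := by
    refine PiLp.ext fun j => ?_
    rw [PiLp.add_apply]
    refine (MemLp.toLp_congr (Γ.memLp_sol z _ j) ((Γ.memLp_sol z c j).add (Γ.memLp_sol z d j))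
      (Eventually.of_forall fun x => ?_)).trans (MemLp.toLp_add (Γ.memLp_sol z c j) (Γ.memLp_sol z d j))
    simp only [sol, Pi.add_apply]
    ring
  map_smul' a c := by
    refine PiLp.ext fun j => ?_
    rw [PiLp.smul_apply]
    refine (MemLp.toLp_congr (Γ.memLp_sol z _ j) ((Γ.memLp_sol z c j).const_smul a)
      (Eventually.of_forall fun x => ?_)).trans (MemLp.toLp_const_smul a (Γ.memLp_sol z c j))
    simp only [sol, Pi.smul_apply, smul_eq_mul]
    ring

theorem coeFn_solLp (z : ℂ) (c : Fin n × Bool → ℂ) (j : Fin n) :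
    (Γ.solLp z c j : ℝ → ℂ) =ᵐ[volume.restrict (Icc (Γ.left j) (Γ.right j))] Γ.sol z c j :=
  (Γ.memLp_sol z c j).coeFn_toLp

theorem mem_eigenspace_iff (α : Fin N → ℝ) (z : ℂ) (f : Γ.L2) :
    f ∈ eigenspace (laplacian Γ α) z ↔ IsLaplacianPair Γ α f (z • f) := by
  have h : f ∈ eigenspace (laplacian Γ α) z ↔ (f, z • f) ∈ (laplacian Γ α).graph := Iff.rfl
  rw [h, laplacian_graph]
  rfl

theorem endpointValue_congr {F G : Fin n → ℝ → ℂ}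
    (h : ∀ j, ∀ x ∈ Icc (Γ.left j) (Γ.right j), F j x = G j x) :
    Γ.endpointValue F = Γ.endpointValue G := by
  funext p
  have hlt := (Γ.left_lt_right p.1).le
  simp only [endpointValue]
  rw [h _ _ (left_mem_Icc.2 hlt), h _ _ (right_mem_Icc.2 hlt)]

theorem normalDeriv_congr {F G : Fin n → ℝ → ℂ}
    (h : ∀ j, ∀ x ∈ Icc (Γ.left j) (Γ.right j), F j x = G j x) :
    Γ.normalDeriv F = Γ.normalDeriv G := by
  funext p
  have hlt := (Γ.left_lt_right p.1).le
  simp only [normalDeriv]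
  rw [h _ _ (left_mem_Icc.2 hlt), h _ _ (right_mem_Icc.2 hlt)]

theorem solLp_mem_eigenspace {α : Fin N → ℝ} {z : ℂ} {x : (Fin n × Bool) ⊕ Fin N → ℂ}
    (hx : Γ.charMatrix α z *ᵥ x = 0) :
    Γ.solLp z (x ∘ Sum.inl) ∈ eigenspace (laplacian Γ α) z := by
  rw [mem_eigenspace_iff]
  refine ⟨_, _, _, Γ.isSobolev22_sol z (x ∘ Sum.inl), fun v => ⟨x (Sum.inr v), fun p hp => ?_, ?_⟩,
    Γ.coeFn_solLp z _, fun j => ?_⟩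
  · have h1 := congrFun hx (Sum.inl p)
    rw [charMatrix_mulVec_inl, Pi.zero_apply, sub_eq_zero, (Finset.mem_filter.1 hp).2] at h1
    exact h1
  · have h1 := congrFun hx (Sum.inr v)
    rw [charMatrix_mulVec_inr, Pi.zero_apply, sub_eq_zero] at h1
    exact h1
  · rw [PiLp.smul_apply]
    filter_upwards [Lp.coeFn_smul z (Γ.solLp z (x ∘ Sum.inl) j), Γ.coeFn_solLp z (x ∘ Sum.inl) j]
      with y hy hy'
    rw [hy, Pi.smul_apply, hy', smul_eq_mul, neg_mul, neg_neg]

theorem exists_solLp_eq {α : Fin N → ℝ} {z : ℂ} {f : Γ.L2}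
    (hf : f ∈ eigenspace (laplacian Γ α) z) :
    ∃ x : (Fin n × Bool) ⊕ Fin N → ℂ, Γ.charMatrix α z *ᵥ x = 0 ∧
      Γ.solLp z (x ∘ Sum.inl) = f := by
  obtain ⟨F, F', F'', hS, hM, hfF, hg⟩ := (Γ.mem_eigenspace_iff α z f).1 hf
  choose d hd hs using hM
  have hz : ∀ j, ∀ᵐ x ∂(volume.restrict (Icc (Γ.left j) (Γ.right j))), F'' j x = -z * F j x := by
    intro j
    have h1 := hg j
    rw [PiLp.smul_apply] at h1
    filter_upwards [h1, hfF j, Lp.coeFn_smul z (f j)] with x hx hx' hx''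
    rw [hx'', Pi.smul_apply, hx', smul_eq_mul] at hx
    rw [neg_mul, hx, neg_neg]
  set c : Fin n × Bool → ℂ := fun p =>
    if p.2 then F' p.1 (Γ.left p.1) else F p.1 (Γ.left p.1) with hc
  have hF : ∀ j, ∀ x ∈ Icc (Γ.left j) (Γ.right j), F j x = Γ.sol z c j x := fun j x hx => by
    simpa [sol, hc] using ((hS j).eq_fundamental (hz j) hx).1
  have hF' : ∀ j, ∀ x ∈ Icc (Γ.left j) (Γ.right j), F' j x = Γ.solDeriv z c j x :=
    fun j x hx => by simpa [solDeriv, hc] using ((hS j).eq_fundamental (hz j) hx).2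
  refine ⟨Sum.elim c d, ?_, PiLp.ext fun j => Lp.ext ?_⟩
  · funext i
    rcases i with p | v
    · rw [charMatrix_mulVec_inl, Sum.elim_comp_inl, Sum.elim_inr, ← Γ.normalDeriv_congr hF',
        hd (Γ.vertexOf p) p (by simp [endpointsAt])]
      simp
    · rw [charMatrix_mulVec_inr, Sum.elim_comp_inl, Sum.elim_inr, ← Γ.endpointValue_congr hF, hs]
      simp
  · rw [Sum.elim_comp_inl]
    refine (Γ.coeFn_solLp z c j).trans (EventuallyEq.trans ?_ (hfF j).symm)
    filter_upwards [ae_restrict_mem measurableSet_Icc] with x hx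
    exact (hF j x hx).symm

theorem solLp_injective (z : ℂ) : Function.Injective (Γ.solLp z) := by
  rw [← LinearMap.ker_eq_bot, LinearMap.ker_eq_bot']
  intro c hc
  funext ⟨j, i⟩
  refine Γ.sol_eq_zero (z := z) ?_ i
  have h1 : Γ.sol z c j =ᵐ[volume.restrict (Icc (Γ.left j) (Γ.right j))] fun _ => 0 := by
    refine (Γ.coeFn_solLp z c j).symm.trans ?_
    rw [hc]
    exact Lp.coeFn_zero _ _ _
  exact Measure.eqOn_Icc_of_ae_eq volume (Γ.left_lt_right j).ne h1
    (Γ.continuous_sol z c j).continuousOn continuousOn_const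

/-- Keeping the coefficient part of a kernel vector and forming the function it describes is a
linear isomorphism onto the eigenspace. -/
theorem spectralMultiplicity_laplacian (α : Fin N → ℝ) (z : ℂ) :
    spectralMultiplicity (laplacian Γ α) z =
      Module.finrank ℂ (LinearMap.ker (Matrix.toLin' (Γ.charMatrix α z))) := by
  let L : LinearMap.ker (Matrix.toLin' (Γ.charMatrix α z)) →ₗ[ℂ] Γ.L2 :=
    (Γ.solLp z ∘ₗ LinearMap.funLeft ℂ ℂ Sum.inl).domRestrict _
  have hL : ∀ x, L x = Γ.solLp z (x.1 ∘ Sum.inl) := fun x => rfl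
  have hinj : Function.Injective L := by
    rw [← LinearMap.ker_eq_bot, LinearMap.ker_eq_bot']
    rintro ⟨x, hx⟩ h0
    rw [hL] at h0
    have h1 := Γ.solLp_injective z (h0.trans (map_zero _).symm)
    exact Subtype.ext (Γ.eq_zero_of_charMatrix_mulVec_eq_zero (by simpa using hx) h1)
  have hrange : LinearMap.range L = eigenspace (laplacian Γ α) z := by
    ext f
    constructor
    · rintro ⟨⟨x, hx⟩, rfl⟩
      exact Γ.solLp_mem_eigenspace (by simpa using hx)
    · intro hf
      obtain ⟨x, hx, rfl⟩ := Γ.exists_solLp_eq hf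
      exact ⟨⟨x, by simpa using hx⟩, rfl⟩
  rw [spectralMultiplicity, ← hrange, ← (LinearEquiv.ofInjective L hinj).rank_eq,
    Module.finrank_eq_rank]

end MetricGraph

/-! ### Bounds off the real axis and proportionality of the determinants. -/

theorem sq_integral_norm_le {a b : ℝ} (hab : a < b) {f : ℝ → ℂ} (hf : Continuous f) :
    (∫ x in a..b, ‖f x‖) ^ 2 ≤ (b - a) * ∫ x in a..b, ‖f x‖ ^ 2 := by
  have hl : 0 < b - a := sub_pos.2 hab
  set m : ℝ := (∫ x in a..b, ‖f x‖) / (b - a) with hm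
  -- Cauchy–Schwarz against the constant function, from the variance of `‖f‖` about its mean `m`.
  have h0 : 0 ≤ ∫ x in a..b, (‖f x‖ ^ 2 - 2 * m * ‖f x‖ + m ^ 2) :=
    intervalIntegral.integral_nonneg hab.le fun x _ => by nlinarith [sq_nonneg (‖f x‖ - m)]
  rw [intervalIntegral.integral_add (Continuous.intervalIntegrable (by fun_prop) _ _)
      (Continuous.intervalIntegrable (by fun_prop) _ _),
    intervalIntegral.integral_sub (Continuous.intervalIntegrable (by fun_prop) _ _)
      (Continuous.intervalIntegrable (by fun_prop) _ _),
    intervalIntegral.integral_const_mul, intervalIntegral.integral_const, smul_eq_mul] at h0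
  have h1 : ∫ x in a..b, ‖f x‖ = m * (b - a) := by rw [hm]; field_simp
  rw [h1] at h0 ⊢
  nlinarith

/-- Integrate `(f' w - f w')' = f (-z w - w'')`. A weight whose slope vanishes at both ends, and
which itself vanishes at one, isolates the derivative of `f` at the other. -/
theorem norm_weighted_boundary_le {a b : ℝ} (hab : a < b) {f f' : ℝ → ℂ} {z : ℂ}
    (hf : ∀ x, HasDerivAt f (f' x) x) (hf' : ∀ x, HasDerivAt f' (-z * f x) x)
    {w w' w'' : ℝ → ℝ} (hw : ∀ x, HasDerivAt w (w' x) x) (hw' : ∀ x, HasDerivAt w' (w'' x) x)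
    (hc : Continuous w'') {A : ℝ} (h1 : ∀ x ∈ Icc a b, |w x| ≤ 1)
    (hA : ∀ x ∈ Icc a b, |w'' x| ≤ A) :
    ‖(f' b * w b - f b * w' b) - (f' a * w a - f a * w' a)‖ ≤
      (‖z‖ + A) * ∫ x in a..b, ‖f x‖ := by
  have hfc : Continuous f := continuous_iff_continuousAt.2 fun x => (hf x).continuousAt
  have hwc : Continuous w := continuous_iff_continuousAt.2 fun x => (hw x).continuousAt
  have hd : ∀ x ∈ uIcc a b, HasDerivAt (fun x => f' x * (w x : ℂ) - f x * (w' x : ℂ))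
      (f x * (-z * w x - w'' x)) x := by
    intro x _
    refine (((hf' x).fun_mul (hw x).ofReal_comp).fun_sub
      ((hf x).fun_mul (hw' x).ofReal_comp)).congr_deriv ?_
    ring
  rw [← intervalIntegral.integral_eq_sub_of_hasDerivAt hd
    (Continuous.intervalIntegrable (by fun_prop) _ _), ← intervalIntegral.integral_const_mul]
  refine intervalIntegral.norm_integral_le_of_norm_le hab.le ?_
    (Continuous.intervalIntegrable (by fun_prop) _ _)
  refine Eventually.of_forall fun x hx => ?_
  have hx' := Ioc_subset_Icc_self hx
  rw [norm_mul, mul_comm]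
  refine mul_le_mul_of_nonneg_right ?_ (norm_nonneg _)
  refine (norm_sub_le _ _).trans (add_le_add ?_ ?_)
  · rw [norm_mul, norm_neg, Complex.norm_real, Real.norm_eq_abs]
    exact mul_le_of_le_one_right (norm_nonneg _) (h1 x hx')
  · rw [Complex.norm_real, Real.norm_eq_abs]
    exact hA x hx'

/-- The derivative at the endpoints of a solution of `-f'' = z f` is bounded by its norm. -/
theorem norm_deriv_endpoint_le {a b : ℝ} (hab : a < b) {f f' : ℝ → ℂ} {z : ℂ}
    (hf : ∀ x, HasDerivAt f (f' x) x) (hf' : ∀ x, HasDerivAt f' (-z * f x) x) :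
    ‖f' a‖ ≤ (‖z‖ + 6 / (b - a) ^ 2) * ∫ x in a..b, ‖f x‖ ∧
      ‖f' b‖ ≤ (‖z‖ + 6 / (b - a) ^ 2) * ∫ x in a..b, ‖f x‖ := by
  have hl : 0 < b - a := sub_pos.2 hab
  have hl0 := hl.ne'
  have ht : ∀ x, HasDerivAt (fun x => (x - a) / (b - a)) (1 / (b - a)) x := fun x =>
    ((hasDerivAt_id x).sub_const a).div_const _
  -- With `t = (x - a) / (b - a)`, the cubic `3t² - 2t³` rises from 0 to 1 with zero slope at both
  -- ends, and its second derivative in `x` is at most `6 / (b - a)²` in modulus. It serves the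
  -- right endpoint; one minus it serves the left.
  have hw : ∀ x, HasDerivAt (fun x => 3 * ((x - a) / (b - a)) ^ 2 - 2 * ((x - a) / (b - a)) ^ 3)
      ((6 * ((x - a) / (b - a)) - 6 * ((x - a) / (b - a)) ^ 2) / (b - a)) x := fun x =>
    ((((ht x).fun_pow 2).const_mul 3).fun_sub (((ht x).fun_pow 3).const_mul 2)).congr_deriv
      (by norm_num; ring)
  have hw' : ∀ x, HasDerivAt
      (fun x => (6 * ((x - a) / (b - a)) - 6 * ((x - a) / (b - a)) ^ 2) / (b - a))
      ((6 - 12 * ((x - a) / (b - a))) / (b - a) ^ 2) x := fun x =>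
    ((((ht x).const_mul 6).fun_sub (((ht x).fun_pow 2).const_mul 6)).div_const _).congr_deriv
      (by norm_num; field_simp; ring)
  have hI : ∀ x ∈ Icc a b, 0 ≤ (x - a) / (b - a) ∧ (x - a) / (b - a) ≤ 1 := fun x hx =>
    ⟨div_nonneg (sub_nonneg.2 hx.1) hl.le, (div_le_one hl).2 (by linarith [hx.2])⟩
  have hA : ∀ x ∈ Icc a b, |(6 - 12 * ((x - a) / (b - a))) / (b - a) ^ 2| ≤ 6 / (b - a) ^ 2 := by
    intro x hx
    obtain ⟨h0, h1⟩ := hI x hx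
    rw [abs_div, abs_of_pos (pow_pos hl 2)]
    gcongr
    rw [abs_le]
    constructor <;> linarith
  have hB : ∀ x ∈ Icc a b,
      |3 * ((x - a) / (b - a)) ^ 2 - 2 * ((x - a) / (b - a)) ^ 3| ≤ 1 ∧
      |1 - (3 * ((x - a) / (b - a)) ^ 2 - 2 * ((x - a) / (b - a)) ^ 3)| ≤ 1 := by
    intro x hx
    obtain ⟨h0, h1⟩ := hI x hx
    generalize (x - a) / (b - a) = t at h0 h1
    have h2 : 0 ≤ t ^ 2 * (3 - 2 * t) := mul_nonneg (sq_nonneg t) (by linarith)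
    have h3 : 0 ≤ (1 - t) ^ 2 * (1 + 2 * t) := mul_nonneg (sq_nonneg _) (by linarith)
    constructor <;> rw [abs_le] <;> constructor <;> nlinarith
  have haa : (a - a) / (b - a) = 0 := by simp
  have hbb : (b - a) / (b - a) = 1 := div_self hl0
  constructor
  · have h := norm_weighted_boundary_le hab hf hf'
      (fun x => (hw x).const_sub 1) (fun x => (hw' x).fun_neg) (by fun_prop)
      (fun x hx => (hB x hx).2) (fun x hx => by rw [abs_neg]; exact hA x hx)
    simp only [haa, hbb] at h
    norm_num at h
    exact h
  · have h := norm_weighted_boundary_le hab hf hf' hw hw' (by fun_prop)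
      (fun x hx => (hB x hx).1) hA
    simp only [haa, hbb] at h
    norm_num at h
    exact h

namespace MetricGraph

variable (Γ : MetricGraph n N)

theorem exists_norm_normalDeriv_sq_le : ∃ C : ℝ, 0 ≤ C ∧
    ∀ (z : ℂ) (c : Fin n × Bool → ℂ) (p : Fin n × Bool),
      ‖Γ.normalDeriv (Γ.solDeriv z c) p‖ ^ 2 ≤ C * (1 + ‖z‖) ^ 2 * Γ.normSq (Γ.sol z c) := by
  set C : Fin n → ℝ := fun j =>
    (1 + 6 / (Γ.right j - Γ.left j) ^ 2) ^ 2 * (Γ.right j - Γ.left j) with hC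
  have hC0 : ∀ j, 0 ≤ C j := fun j =>
    mul_nonneg (sq_nonneg _) (sub_nonneg.2 (Γ.left_lt_right j).le)
  refine ⟨∑ j, C j, Finset.sum_nonneg fun j _ => hC0 j, fun z c p => ?_⟩
  obtain ⟨h1, h2⟩ := norm_deriv_endpoint_le (Γ.left_lt_right p.1) (Γ.hasDerivAt_sol z c p.1)
    (Γ.hasDerivAt_solDeriv z c p.1)
  set B : ℝ := 6 / (Γ.right p.1 - Γ.left p.1) ^ 2 with hB
  have hB0 : 0 ≤ B := by positivity
  set I : ℝ := ∫ x in Γ.left p.1..Γ.right p.1, ‖Γ.sol z c p.1 x‖ with hI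
  have hI0 : 0 ≤ I := intervalIntegral.integral_nonneg (Γ.left_lt_right p.1).le
    fun _ _ => norm_nonneg _
  have h3 : ‖Γ.normalDeriv (Γ.solDeriv z c) p‖ ≤ (‖z‖ + B) * I := by
    unfold normalDeriv
    split_ifs
    · rwa [norm_neg]
    · exact h1
  have h4 : ‖z‖ + B ≤ (1 + B) * (1 + ‖z‖) := by nlinarith [norm_nonneg z, mul_nonneg hB0 (norm_nonneg z)]
  have h5 := sq_integral_norm_le (Γ.left_lt_right p.1) (Γ.continuous_sol z c p.1)
  have h6 : ∫ x in Γ.left p.1..Γ.right p.1, ‖Γ.sol z c p.1 x‖ ^ 2 ≤ Γ.normSq (Γ.sol z c) :=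
    Finset.single_le_sum (f := fun j => ∫ x in Γ.left j..Γ.right j, ‖Γ.sol z c j x‖ ^ 2)
      (fun j _ => Γ.integral_norm_sq_nonneg _ j) (Finset.mem_univ p.1)
  have h7 : C p.1 ≤ ∑ j, C j := Finset.single_le_sum (fun j _ => hC0 j) (Finset.mem_univ p.1)
  have h8 := Γ.integral_norm_sq_nonneg (Γ.sol z c) p.1
  calc ‖Γ.normalDeriv (Γ.solDeriv z c) p‖ ^ 2 ≤ ((1 + B) * (1 + ‖z‖) * I) ^ 2 := by
        refine pow_le_pow_left₀ (norm_nonneg _) (h3.trans ?_) 2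
        gcongr
    _ = ((1 + B) * (1 + ‖z‖)) ^ 2 * I ^ 2 := by ring
    _ ≤ ((1 + B) * (1 + ‖z‖)) ^ 2 * ((Γ.right p.1 - Γ.left p.1) *
          ∫ x in Γ.left p.1..Γ.right p.1, ‖Γ.sol z c p.1 x‖ ^ 2) := by gcongr
    _ = C p.1 * (1 + ‖z‖) ^ 2 * ∫ x in Γ.left p.1..Γ.right p.1, ‖Γ.sol z c p.1 x‖ ^ 2 := by
        rw [hC]; ring
    _ ≤ _ := by
        have := Finset.sum_nonneg fun j (_ : j ∈ Finset.univ) => hC0 j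
        gcongr

theorem sub_conj_mul_normSq (α : Fin N → ℝ) (z : ℂ) (x : (Fin n × Bool) ⊕ Fin N → ℂ)
    (hx : ∀ p, (Γ.charMatrix α z *ᵥ x) (Sum.inl p) = 0) :
    (z - conj z) * Γ.normSq (Γ.sol z (x ∘ Sum.inl)) =
      ∑ v, (x (Sum.inr v) * conj ((Γ.charMatrix α z *ᵥ x) (Sum.inr v)) -
        (Γ.charMatrix α z *ᵥ x) (Sum.inr v) * conj (x (Sum.inr v))) := by
  rw [← pairing_self, Γ.green_charMatrix α]
  simp [hx]

theorem det_charMatrix_ne_zero (α : Fin N → ℝ) {z : ℂ} (hz : z.im ≠ 0) :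
    (Γ.charMatrix α z).det ≠ 0 := by
  intro h0
  obtain ⟨x, hx0, hx⟩ := Matrix.exists_mulVec_eq_zero_iff.2 h0
  have h1 := Γ.sub_conj_mul_normSq α z x fun p => by rw [hx]; rfl
  rw [hx] at h1
  simp only [Pi.zero_apply, map_zero, mul_zero, zero_mul, sub_zero, Finset.sum_const_zero] at h1
  have h2 : z - conj z ≠ 0 := by
    rw [Complex.sub_conj]
    simp [hz]
  exact hx0 (Γ.eq_zero_of_charMatrix_mulVec_eq_zero hx (Γ.sol_eq_zero_of_normSq_eq_zero
    (Complex.ofReal_eq_zero.1 ((mul_eq_zero.1 h1).resolve_left h2))))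

/-- A column of the inverse solves the system with unit residual at one vertex `w`. With `S` the
squared norm of its solution, Green's identity gives `|Im z| S ≤ ‖x_w‖`, while the endpoint bound
gives `‖x_v‖² ≤ E S`, where `E = C (1 + ‖z‖)²`. Taking `v = w` bounds `‖x_w‖ |Im z|` by `E`; the
other entries follow. -/
theorem exists_norm_inv_charMatrix_le : ∃ C : ℝ, 0 ≤ C ∧ ∀ (α : Fin N → ℝ) (z : ℂ), z.im ≠ 0 →
    ∀ v w, ‖(Γ.charMatrix α z)⁻¹ (Sum.inr v) (Sum.inr w)‖ * |z.im| ≤ C * (1 + ‖z‖) ^ 2 := by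
  obtain ⟨C, hC, hb⟩ := Γ.exists_norm_normalDeriv_sq_le
  refine ⟨C, hC, fun α z hz v w => ?_⟩
  have hdet := Γ.det_charMatrix_ne_zero α hz
  set x : (Fin n × Bool) ⊕ Fin N → ℂ :=
    (Γ.charMatrix α z)⁻¹ *ᵥ Pi.single (Sum.inr w) 1 with hxdef
  have hTx : Γ.charMatrix α z *ᵥ x = Pi.single (Sum.inr w) 1 := by
    rw [hxdef, Matrix.mulVec_mulVec, Matrix.mul_nonsing_inv _ hdet.isUnit, Matrix.one_mulVec]
  have hxv : ∀ v, (Γ.charMatrix α z)⁻¹ (Sum.inr v) (Sum.inr w) = x (Sum.inr v) := by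
    intro v
    rw [hxdef, Matrix.mulVec_single_one]
    rfl
  rw [hxv]
  set S := Γ.normSq (Γ.sol z (x ∘ Sum.inl)) with hS
  have hS0 : 0 ≤ S := Finset.sum_nonneg fun j _ => Γ.integral_norm_sq_nonneg _ j
  have hinl : ∀ p, (Γ.charMatrix α z *ᵥ x) (Sum.inl p) = 0 := fun p => by rw [hTx]; simp
  have hle : ∀ v, ‖x (Sum.inr v)‖ ^ 2 ≤ C * (1 + ‖z‖) ^ 2 * S := by
    intro v
    obtain ⟨p, rfl⟩ := Γ.vertexOf_surjective v
    have h1 := hinl p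
    rw [charMatrix_mulVec_inl, sub_eq_zero] at h1
    rw [← h1]
    exact hb z _ p
  have hIm : |z.im| * S ≤ ‖x (Sum.inr w)‖ := by
    have h1 := Γ.sub_conj_mul_normSq α z x hinl
    rw [hTx, Finset.sum_eq_single w (fun v _ hv => by simp [hv]) (by simp)] at h1
    simp only [Pi.single_eq_same, map_one, mul_one, one_mul, Complex.sub_conj] at h1
    have h2 := congrArg (fun u => ‖u‖) h1
    simp only [norm_mul, Complex.norm_real, Complex.norm_I, Real.norm_eq_abs, mul_one,
      abs_two] at h2
    rw [abs_of_nonneg (show 0 ≤ Γ.normSq (Γ.sol z (x ∘ Sum.inl)) from hS0)] at h2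
    have h3 := Complex.abs_im_le_norm (x (Sum.inr w))
    nlinarith
  set E := C * (1 + ‖z‖) ^ 2 with hE
  have hE0 : 0 ≤ E := by positivity
  have hw : ‖x (Sum.inr w)‖ * |z.im| ≤ E := by
    by_contra! hlt
    have hpos : 0 < ‖x (Sum.inr w)‖ := by
      rcases (norm_nonneg (x (Sum.inr w))).eq_or_lt with h | h
      · rw [← h, zero_mul] at hlt
        linarith
      · exact h
    have h1 : ‖x (Sum.inr w)‖ ^ 2 * |z.im| ≤ E * ‖x (Sum.inr w)‖ :=
      calc _ ≤ E * S * |z.im| := mul_le_mul_of_nonneg_right (hle w) (abs_nonneg _)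
        _ = E * (|z.im| * S) := by ring
        _ ≤ _ := mul_le_mul_of_nonneg_left hIm hE0
    nlinarith
  refine abs_le_of_sq_le_sq' ?_ hE0 |>.2
  calc (‖x (Sum.inr v)‖ * |z.im|) ^ 2 = ‖x (Sum.inr v)‖ ^ 2 * |z.im| ^ 2 := by ring
    _ ≤ E * S * |z.im| ^ 2 := mul_le_mul_of_nonneg_right (hle v) (by positivity)
    _ = E * (|z.im| * S * |z.im|) := by ring
    _ ≤ E * (‖x (Sum.inr w)‖ * |z.im|) := by gcongr
    _ ≤ E * E := by gcongr
    _ = E ^ 2 := by ring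

/-- Only the vertex block depends on the coupling constants, so the quotient of the matrices is
block triangular with an identity block. -/
theorem det_charMatrix_eq (α β : Fin N → ℝ) (z : ℂ) (hz : z.im ≠ 0) :
    (Γ.charMatrix α z).det = (1 + (Matrix.diagonal fun v => ((β v - α v : ℝ) : ℂ)) *
      ((Γ.charMatrix β z)⁻¹).toBlocks₂₂).det * (Γ.charMatrix β z).det := by
  have hdet := Γ.det_charMatrix_ne_zero β hz
  have h1 : Γ.charMatrix α z = Γ.charMatrix β z +
      Matrix.fromBlocks 0 0 0 (Matrix.diagonal fun v => ((β v - α v : ℝ) : ℂ)) := by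
    rw [charMatrix, charMatrix, Matrix.fromBlocks_add]
    congr 1
    · simp
    · simp
    · simp
    · rw [Matrix.diagonal_neg, Matrix.diagonal_neg, Matrix.diagonal_add]
      congr 1
      funext v
      push_cast
      ring
  have h2 : Γ.charMatrix α z * (Γ.charMatrix β z)⁻¹ = Matrix.fromBlocks 1 0
      ((Matrix.diagonal fun v => ((β v - α v : ℝ) : ℂ)) * ((Γ.charMatrix β z)⁻¹).toBlocks₂₁)
      (1 + (Matrix.diagonal fun v => ((β v - α v : ℝ) : ℂ)) *
        ((Γ.charMatrix β z)⁻¹).toBlocks₂₂) := by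
    rw [h1, add_mul, Matrix.mul_nonsing_inv _ hdet.isUnit]
    conv_lhs =>
      rw [← Matrix.fromBlocks_toBlocks (Γ.charMatrix β z)⁻¹, Matrix.fromBlocks_multiply,
        ← Matrix.fromBlocks_one, Matrix.fromBlocks_add]
    simp
  have h3 := congrArg Matrix.det h2
  rw [Matrix.det_mul, Matrix.det_fromBlocks_zero₁₂, Matrix.det_one, one_mul,
    Matrix.det_nonsing_inv, Ring.inverse_eq_inv'] at h3
  rw [← h3, mul_assoc, inv_mul_cancel₀ hdet, mul_one]

theorem exists_norm_det_ratio_le (α β : Fin N → ℝ) : ∃ K : ℝ, ∀ z : ℂ, z.im ≠ 0 →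
    ‖(Γ.charMatrix α z).det / (Γ.charMatrix β z).det‖ * |z.im| ^ N ≤ K * (1 + ‖z‖) ^ (2 * N) := by
  obtain ⟨C, hC, hb⟩ := Γ.exists_norm_inv_charMatrix_le
  set A : ℝ := ∑ v, |β v - α v| with hA
  have hA0 : 0 ≤ A := Finset.sum_nonneg fun _ _ => abs_nonneg _
  refine ⟨N.factorial * (1 + A * C) ^ N, fun z hz => ?_⟩
  rw [Γ.det_charMatrix_eq α β z hz, mul_div_cancel_right₀ _ (Γ.det_charMatrix_ne_zero β hz)]
  set Y := 1 + (Matrix.diagonal fun v => ((β v - α v : ℝ) : ℂ)) *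
      ((Γ.charMatrix β z)⁻¹).toBlocks₂₂ with hY
  -- Each row is scaled by `|Im z|`, which cancels the singularity of the inverse; the Leibniz
  -- formula for the determinant then produces the exponents `N` and `2 * N`.
  have hentry : ∀ v w, ‖((|z.im| : ℝ) : ℂ) * Y v w‖ ≤ (1 + A * C) * (1 + ‖z‖) ^ 2 := by
    intro v w
    have h1 : ‖Y v w‖ ≤ 1 + A * ‖(Γ.charMatrix β z)⁻¹ (Sum.inr v) (Sum.inr w)‖ := by
      rw [hY, Matrix.add_apply, Matrix.diagonal_mul]
      refine (norm_add_le _ _).trans (add_le_add ?_ ?_)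
      · rw [Matrix.one_apply]
        split_ifs <;> simp
      · rw [norm_mul, Complex.norm_real, Real.norm_eq_abs]
        refine mul_le_mul_of_nonneg_right ?_ (norm_nonneg _)
        exact Finset.single_le_sum (f := fun v => |β v - α v|) (fun _ _ => abs_nonneg _)
          (Finset.mem_univ v)
    have h2 := hb β z hz v w
    have h3 : |z.im| ≤ (1 + ‖z‖) ^ 2 := by
      nlinarith [Complex.abs_im_le_norm z, norm_nonneg z]
    rw [norm_mul, Complex.norm_real, Real.norm_eq_abs, abs_abs]
    calc _ ≤ |z.im| * (1 + A * ‖(Γ.charMatrix β z)⁻¹ (Sum.inr v) (Sum.inr w)‖) := by gcongr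
      _ = |z.im| + A * (‖(Γ.charMatrix β z)⁻¹ (Sum.inr v) (Sum.inr w)‖ * |z.im|) := by ring
      _ ≤ (1 + ‖z‖) ^ 2 + A * (C * (1 + ‖z‖) ^ 2) := by gcongr
      _ = _ := by ring
  have h4 := Matrix.det_le (A := ((|z.im| : ℝ) : ℂ) • Y) (abv := NormedField.toAbsoluteValue ℂ)
    (x := (1 + A * C) * (1 + ‖z‖) ^ 2) hentry
  rw [Matrix.det_smul, Fintype.card_fin] at h4
  have h5 : NormedField.toAbsoluteValue ℂ (((|z.im| : ℝ) : ℂ) ^ N * Y.det) =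
      ‖Y.det‖ * |z.im| ^ N := by
    rw [map_mul, map_pow, mul_comm]
    congr 2
    exact (Complex.norm_real _).trans (abs_abs _)
  rw [h5, nsmul_eq_mul, mul_pow, ← pow_mul, ← mul_assoc] at h4
  exact h4

/-- A nonzero exponent `N` makes the growth bound trivial on the real axis, where the quotient is
not controlled directly. -/
theorem vertex_count_ne_zero (Γ : MetricGraph n N) : N ≠ 0 := by
  rintro rfl
  exact (Γ.vertexOf (⟨0, Γ.edges_nonempty⟩, false)).elim0

theorem differentiable_det_charMatrix (α : Fin N → ℝ) :
    Differentiable ℂ fun z => (Γ.charMatrix α z).det := by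
  simp only [Matrix.det_apply]
  exact Differentiable.fun_sum fun σ _ => (Differentiable.fun_finsetProd fun i _ =>
    Γ.differentiable_charMatrix α _ _).const_smul _

theorem exists_polynomial_mul_det_charMatrix {α β : Fin N → ℝ}
    (h : spectralMultiplicity (laplacian Γ α) = spectralMultiplicity (laplacian Γ β)) :
    ∃ P : Polynomial ℂ, ∀ z, (Γ.charMatrix α z).det = P.eval z * (Γ.charMatrix β z).det := by
  obtain ⟨F, hF, hFd⟩ := exists_entire_mul_eq (Γ.differentiable_det_charMatrix α)
    (Γ.differentiable_det_charMatrix β) (fun z => by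
      have h1 := congrFun h z
      rw [spectralMultiplicity_laplacian, spectralMultiplicity_laplacian, Nat.cast_inj] at h1
      rw [analyticOrderAt_det_charMatrix, analyticOrderAt_det_charMatrix, h1])
    (fun z => by
      rw [analyticOrderAt_det_charMatrix]
      exact ENat.natCast_ne_top _)
  obtain ⟨K, hK⟩ := Γ.exists_norm_det_ratio_le α β
  have hN := Γ.vertex_count_ne_zero
  have hK0 : 0 ≤ K := by
    have h1 := (mul_nonneg (norm_nonneg _) (by positivity)).trans (hK Complex.I (by simp))
    exact nonneg_of_mul_nonneg_left h1 (by positivity)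
  obtain ⟨P, hP⟩ := exists_polynomial_of_norm_mul_im_pow_le hF hN (K := K) (M := 2 * N) (by
    intro z
    by_cases hz : z.im = 0
    · rw [hz, abs_zero, zero_pow hN, mul_zero]
      positivity
    · have h1 := hK z hz
      rwa [hFd z, mul_div_cancel_right₀ _ (Γ.det_charMatrix_ne_zero β hz)] at h1)
  exact ⟨P, fun z => by rw [← hP]; exact hFd z⟩

/-- Isospectral graph Laplacians have proportional characteristic functions. -/
theorem exists_const_mul_det_charMatrix {α β : Fin N → ℝ}
    (h : spectralMultiplicity (laplacian Γ α) = spectralMultiplicity (laplacian Γ β)) :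
    ∃ c : ℂ, c ≠ 0 ∧ ∀ z, (Γ.charMatrix α z).det = c * (Γ.charMatrix β z).det := by
  obtain ⟨P, hP⟩ := Γ.exists_polynomial_mul_det_charMatrix h
  obtain ⟨Q, hQ⟩ := Γ.exists_polynomial_mul_det_charMatrix h.symm
  -- The determinants do not vanish at nonreal points, so the identity can be checked on that
  -- infinite set.
  have hPQ : P * Q = 1 := by
    refine Polynomial.eq_of_infinite_eval_eq _ _ (Set.Infinite.mono (s := {z : ℂ | z.im ≠ 0})
      (fun z hz => ?_) ?_)
    · have h1 := hP z
      rw [hQ z, ← mul_assoc] at h1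
      have h2 := mul_right_cancel₀ (Γ.det_charMatrix_ne_zero α hz) ((one_mul _).trans h1)
      simpa using h2.symm
    · refine Set.infinite_of_injective_forall_mem (f := fun k : ℕ => ((k : ℂ) + 1) * Complex.I)
        (fun k l hkl => ?_) (fun k => ?_)
      · simpa using hkl
      · have : (k : ℝ) + 1 ≠ 0 := by positivity
        simpa using this
  obtain ⟨c, hc, rfl⟩ := Polynomial.isUnit_iff.1 (IsUnit.of_mul_eq_one _ hPQ)
  exact ⟨c, hc.ne_zero, fun z => by simpa using hP z⟩

end MetricGraph

/-! ### Polynomial asymptotics with superpolynomially small error. -/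

/-- The function `f` of a real variable agrees with the polynomial `P` up to an error that decays
faster than every power. -/
def IsAsympPoly (f : ℝ → ℂ) (P : Polynomial ℂ) : Prop :=
  SuperpolynomialDecay atTop (fun s : ℝ => (s : ℂ)) fun s => f s - P.eval (s : ℂ)

theorem isAsympPoly_eval (P : Polynomial ℂ) : IsAsympPoly (fun s => P.eval (s : ℂ)) P :=
  (superpolynomialDecay_zero _ _).congr fun s => by simp

theorem IsAsympPoly.add {f g : ℝ → ℂ} {P Q : Polynomial ℂ} (hf : IsAsympPoly f P)
    (hg : IsAsympPoly g Q) : IsAsympPoly (fun s => f s + g s) (P + Q) :=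
  (SuperpolynomialDecay.add hf hg).congr fun s => by
    simp only [Pi.add_apply, Polynomial.eval_add]
    ring

/-- `f g - P Q = (f - P)(g - Q) + (f - P) Q + P (g - Q)`. The last two terms are why the error must
decay faster than every power. -/
theorem IsAsympPoly.mul {f g : ℝ → ℂ} {P Q : Polynomial ℂ} (hf : IsAsympPoly f P)
    (hg : IsAsympPoly g Q) : IsAsympPoly (fun s => f s * g s) (P * Q) :=
  (((SuperpolynomialDecay.mul hf hg).add (hf.mul_polynomial Q)).add (hg.polynomial_mul P)).congr
    fun s => by
      simp only [Pi.add_apply, Pi.mul_apply, Polynomial.eval_mul]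
      ring

theorem IsAsympPoly.const_mul {f : ℝ → ℂ} {P : Polynomial ℂ} (hf : IsAsympPoly f P) (c : ℂ) :
    IsAsympPoly (fun s => c * f s) (Polynomial.C c * P) := by
  simpa using (isAsympPoly_eval (Polynomial.C c)).mul hf

theorem IsAsympPoly.sum {ι : Type*} {t : Finset ι} {f : ι → ℝ → ℂ} {P : ι → Polynomial ℂ}
    (h : ∀ i ∈ t, IsAsympPoly (f i) (P i)) :
    IsAsympPoly (fun s => ∑ i ∈ t, f i s) (∑ i ∈ t, P i) := by
  classical
  induction t using Finset.induction_on with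
  | empty => simpa using isAsympPoly_eval 0
  | insert a t ha ih =>
    simp only [Finset.sum_insert ha]
    exact (h a (by simp)).add (ih fun i hi => h i (by simp [hi]))

theorem IsAsympPoly.prod {ι : Type*} {t : Finset ι} {f : ι → ℝ → ℂ} {P : ι → Polynomial ℂ}
    (h : ∀ i ∈ t, IsAsympPoly (f i) (P i)) :
    IsAsympPoly (fun s => ∏ i ∈ t, f i s) (∏ i ∈ t, P i) := by
  classical
  induction t using Finset.induction_on with
  | empty => simpa using isAsympPoly_eval 1
  | insert a t ha ih =>
    simp only [Finset.prod_insert ha]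
    exact (h a (by simp)).mul (ih fun i hi => h i (by simp [hi]))

theorem IsAsympPoly.det {ι : Type*} [Fintype ι] [DecidableEq ι] {M : ℝ → Matrix ι ι ℂ}
    {P : Matrix ι ι (Polynomial ℂ)} (h : ∀ i k, IsAsympPoly (fun s => M s i k) (P i k)) :
    IsAsympPoly (fun s => (M s).det) P.det := by
  simp only [Matrix.det_apply']
  refine IsAsympPoly.sum fun σ _ => ?_
  simpa using (IsAsympPoly.prod fun i _ => h (σ i) i).const_mul ((Equiv.Perm.sign σ : ℤ) : ℂ)

theorem IsAsympPoly.congr {f g : ℝ → ℂ} {P : Polynomial ℂ} (hf : IsAsympPoly f P)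
    (h : f =ᶠ[atTop] g) : IsAsympPoly g P :=
  SuperpolynomialDecay.congr' hf (h.mono fun s hs => by simp only [hs])

theorem eq_zero_of_tendsto_eval_zero {P : Polynomial ℂ}
    (h : Tendsto (fun s : ℝ => P.eval (s : ℂ)) atTop (𝓝 0)) : P = 0 := by
  by_cases hd : 0 < P.degree
  · have h1 := P.tendsto_norm_atTop hd (l := atTop) (z := fun s : ℝ => (s : ℂ))
      (by simpa using! tendsto_abs_atTop_atTop)
    exact absurd h.norm (not_tendsto_nhds_of_tendsto_atTop h1 _)
  · rw [Polynomial.eq_C_of_degree_le_zero (not_lt.1 hd)] at h ⊢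
    simp only [Polynomial.eval_C] at h
    rw [tendsto_nhds_unique tendsto_const_nhds h, Polynomial.C_0]

theorem IsAsympPoly.unique {f : ℝ → ℂ} {P Q : Polynomial ℂ} (hP : IsAsympPoly f P)
    (hQ : IsAsympPoly f Q) : P = Q := by
  have h1 : Tendsto (fun s : ℝ => f s - P.eval (s : ℂ)) atTop (𝓝 0) := by simpa using! hP 0
  have h2 : Tendsto (fun s : ℝ => f s - Q.eval (s : ℂ)) atTop (𝓝 0) := by simpa using! hQ 0
  rw [← sub_eq_zero]
  refine eq_zero_of_tendsto_eval_zero ?_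
  have h3 := h2.sub h1
  rw [sub_zero] at h3
  refine h3.congr fun s => ?_
  rw [Polynomial.eval_sub]
  ring

theorem isAsympPoly_zero_of_norm_le {f : ℝ → ℂ} {C l : ℝ} (hl : 0 < l)
    (h : ∀ᶠ s in atTop, ‖f s‖ ≤ C * Real.exp (-l * s)) : IsAsympPoly f 0 := by
  intro k
  have h1 := (tendsto_rpow_mul_exp_neg_mul_atTop_nhds_zero k l hl).const_mul C
  rw [mul_zero] at h1
  refine squeeze_zero_norm' ?_ h1
  filter_upwards [h, eventually_ge_atTop 0] with s hs hs0
  rw [Polynomial.eval_zero, sub_zero, norm_mul, norm_pow, Complex.norm_real,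
    Real.norm_of_nonneg hs0, Real.rpow_natCast, mul_left_comm]
  gcongr

/-- `4 sinh x = 2 exp x - 2 exp (-x)`, where `exp (-x) ≤ 1` and `exp x ≥ 2` for `x ≥ 1`. -/
theorem exp_le_four_mul_sinh {x : ℝ} (hx : 1 ≤ x) : Real.exp x ≤ 4 * Real.sinh x := by
  rw [Real.sinh_eq]
  have h1 : Real.exp (-x) ≤ 1 := Real.exp_le_one_iff.2 (by linarith)
  have h2 := Real.add_one_le_exp x
  linarith

theorem isAsympPoly_csch {l : ℝ} (hl : 0 < l) :
    IsAsympPoly (fun s => 1 / (Real.sinh (s * l) : ℂ)) 0 := by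
  refine isAsympPoly_zero_of_norm_le (C := 4) hl ?_
  filter_upwards [eventually_ge_atTop (1 / l)] with s hs
  have hx : 1 ≤ s * l := (div_le_iff₀ hl).1 hs
  have h1 := exp_le_four_mul_sinh hx
  have h2 := Real.exp_pos (s * l)
  have h3 : 0 < Real.sinh (s * l) := by linarith
  rw [norm_div, norm_one, Complex.norm_real, Real.norm_of_nonneg h3.le, neg_mul, mul_comm l,
    Real.exp_neg, div_le_iff₀ h3, mul_right_comm, ← div_eq_mul_inv, le_div_iff₀ h2, one_mul]
  exact h1

theorem isAsympPoly_coth_sub_one {l : ℝ} (hl : 0 < l) :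
    IsAsympPoly (fun s => (Real.cosh (s * l) : ℂ) / (Real.sinh (s * l) : ℂ) - 1) 0 := by
  refine isAsympPoly_zero_of_norm_le (C := 4) hl ?_
  filter_upwards [eventually_ge_atTop (1 / l)] with s hs
  have hx : 1 ≤ s * l := (div_le_iff₀ hl).1 hs
  have h1 := exp_le_four_mul_sinh hx
  have h2 := Real.exp_pos (s * l)
  have h3 : 0 < Real.sinh (s * l) := by linarith
  have h4 : (Real.cosh (s * l) : ℂ) / (Real.sinh (s * l) : ℂ) - 1 =
      ((Real.exp (-(s * l)) / Real.sinh (s * l) : ℝ) : ℂ) := by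
    rw [← Real.cosh_sub_sinh]
    have : (Real.sinh (s * l) : ℂ) ≠ 0 := by exact_mod_cast h3.ne'
    push_cast at this ⊢
    field_simp
  rw [h4, Complex.norm_real, Real.norm_of_nonneg (by positivity), neg_mul, mul_comm l,
    mul_comm 4, div_eq_mul_inv]
  refine mul_le_mul_of_nonneg_left ?_ (Real.exp_pos _).le
  rw [inv_le_iff_one_le_mul₀ h3]
  have := Real.add_one_le_exp (s * l)
  linarith

/-! ### The characteristic determinant at `-s²` as `s → ∞`. -/

namespace MetricGraph

variable (Γ : MetricGraph n N)

/-- The coefficients of the solution of `f'' = s² f` with given normal derivatives at the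
endpoints. -/
def neumannCoeff (s : ℝ) : (Fin n × Bool → ℂ) →ₗ[ℂ] (Fin n × Bool → ℂ) where
  toFun y p := if p.2 then y (p.1, false) else
    -(y (p.1, false) * Real.cosh (s * (Γ.right p.1 - Γ.left p.1)) + y (p.1, true)) /
      (s * Real.sinh (s * (Γ.right p.1 - Γ.left p.1)))
  map_add' x y := by
    funext p
    simp only [Pi.add_apply]
    split_ifs <;> ring
  map_smul' a x := by
    funext p
    simp only [Pi.smul_apply, smul_eq_mul, RingHom.id_apply]
    split_ifs <;> ring

theorem sinh_edge_ne_zero {s : ℝ} (hs : 0 < s) (j : Fin n) :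
    (Real.sinh (s * (Γ.right j - Γ.left j)) : ℂ) ≠ 0 := by
  have h := Real.sinh_pos_iff.2 (mul_pos hs (sub_pos.2 (Γ.left_lt_right j)))
  exact_mod_cast h.ne'

theorem sinSol_neg_sq {s : ℝ} (hs : 0 < s) (t : ℝ) :
    sinSol (-(s : ℂ) ^ 2) t = Real.sinh (s * t) / s := by
  have hs' : (s : ℂ) ≠ 0 := by exact_mod_cast hs.ne'
  rw [eq_div_iff hs', mul_comm, mul_sinSol_neg_sq]

theorem solNormalDerivMap_neumannCoeff {s : ℝ} (hs : 0 < s) (y : Fin n × Bool → ℂ) :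
    Γ.solNormalDerivMap (-(s : ℂ) ^ 2) (Γ.neumannCoeff s y) = y := by
  have hs' : (s : ℂ) ≠ 0 := by exact_mod_cast hs.ne'
  funext ⟨j, i⟩
  have h1 := Γ.sinh_edge_ne_zero hs j
  cases i
  · simp [solNormalDerivMap, normalDeriv, solDeriv_left, neumannCoeff]
  · simp only [solNormalDerivMap, LinearMap.coe_mk, AddHom.coe_mk, normalDeriv, solDeriv,
      neumannCoeff, cosSol_neg_sq, sinSol_neg_sq hs, if_true, Bool.false_eq_true, if_false]
    field_simp
    ring

theorem solValueMap_neumannCoeff {s : ℝ} (hs : 0 < s) (y : Fin n × Bool → ℂ) (j : Fin n)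
    (i : Bool) : Γ.solValueMap (-(s : ℂ) ^ 2) (Γ.neumannCoeff s y) (j, i) =
      -(y (j, i) * Real.cosh (s * (Γ.right j - Γ.left j)) + y (j, !i)) /
        (s * Real.sinh (s * (Γ.right j - Γ.left j))) := by
  have hs' : (s : ℂ) ≠ 0 := by exact_mod_cast hs.ne'
  have h1 := Γ.sinh_edge_ne_zero hs j
  cases i
  · simp [solValueMap, endpointValue, sol_left, neumannCoeff]
  · have h2 : (Real.cosh (s * (Γ.right j - Γ.left j)) : ℂ) ^ 2 =
        (Real.sinh (s * (Γ.right j - Γ.left j)) : ℂ) ^ 2 + 1 := by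
      exact_mod_cast Real.cosh_sq _
    simp only [solValueMap, LinearMap.coe_mk, AddHom.coe_mk, endpointValue, sol,
      neumannCoeff, cosSol_neg_sq, sinSol_neg_sq hs, if_true, Bool.false_eq_true, if_false,
      Bool.not_true]
    field_simp
    linear_combination (-y (j, false)) * h2

/-- The deviation of `-s` times the Neumann-to-Dirichlet matrix at `-s²` from the identity. -/
def neumannRemainder (s : ℝ) : Matrix (Fin n × Bool) (Fin n × Bool) ℂ :=
  (-(s : ℂ)) • LinearMap.toMatrix' (Γ.solValueMap (-(s : ℂ) ^ 2) ∘ₗ Γ.neumannCoeff s) - 1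

theorem neumannRemainder_apply {s : ℝ} (hs : 0 < s) (j k : Fin n) (a b : Bool) :
    Γ.neumannRemainder s (j, a) (k, b) = if j = k then
      (if a = b then (Real.cosh (s * (Γ.right j - Γ.left j)) : ℂ) /
          Real.sinh (s * (Γ.right j - Γ.left j)) - 1
        else 1 / (Real.sinh (s * (Γ.right j - Γ.left j)) : ℂ)) else 0 := by
  have hs' : (s : ℂ) ≠ 0 := by exact_mod_cast hs.ne'
  have h1 := Γ.sinh_edge_ne_zero hs j
  rw [neumannRemainder, Matrix.sub_apply, Matrix.smul_apply, LinearMap.toMatrix'_apply,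
    LinearMap.comp_apply, solValueMap_neumannCoeff _ hs, smul_eq_mul, Matrix.one_apply]
  by_cases hjk : j = k
  · subst hjk
    by_cases hab : a = b
    · subst hab
      simp
      field_simp
    · obtain rfl : (!a) = b := by cases a <;> cases b <;> simp_all
      simp [hab]
      field_simp
  · simp [hjk]

theorem isAsympPoly_neumannRemainder (p q : Fin n × Bool) :
    IsAsympPoly (fun s => Γ.neumannRemainder s p q) 0 := by
  obtain ⟨j, a⟩ := p
  obtain ⟨k, b⟩ := q
  have hl := sub_pos.2 (Γ.left_lt_right j)
  have h : IsAsympPoly (fun s => if j = k then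
      (if a = b then (Real.cosh (s * (Γ.right j - Γ.left j)) : ℂ) /
          Real.sinh (s * (Γ.right j - Γ.left j)) - 1
        else 1 / (Real.sinh (s * (Γ.right j - Γ.left j)) : ℂ)) else 0) 0 := by
    split_ifs
    · exact isAsympPoly_coth_sub_one hl
    · exact isAsympPoly_csch hl
    · simpa using isAsympPoly_eval 0
  refine h.congr ?_
  filter_upwards [eventually_gt_atTop 0] with s hs
  exact (Γ.neumannRemainder_apply hs j k a b).symm

/-- This is where the valences enter: the identity part of the Neumann-to-Dirichlet matrix, summed
over each vertex, counts its endpoints. -/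
theorem incidence_transpose_mul_self :
    Γ.incidenceᵀ * Γ.incidence = Matrix.diagonal fun v => (Γ.valence v : ℂ) := by
  ext v w
  have h : (Γ.incidenceᵀ * Γ.incidence) v w = (Γ.incidenceᵀ *ᵥ (fun p => Γ.incidence p w)) v := rfl
  rw [h, incidence_transpose_mulVec, Matrix.diagonal_apply]
  have h2 : ∀ p ∈ Γ.endpointsAt v, Γ.incidence p w = if v = w then 1 else 0 := by
    intro p hp
    simp [incidence, (Finset.mem_filter.1 hp).2]
  rw [Finset.sum_congr rfl h2]
  split_ifs <;> simp [valence]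

/-- The matrix whose determinant is, up to elementary factors, that of `charMatrix` at `-s²`. -/
def vertexMatrix (α : Fin N → ℝ) (s : ℝ) : Matrix (Fin N) (Fin N) ℂ :=
  (Matrix.diagonal fun v => (α v : ℂ) * s + (Γ.valence v : ℂ)) +
    Γ.incidenceᵀ * Γ.neumannRemainder s * Γ.incidence

/-- A Schur complement: the edge coefficients are eliminated by solving the Neumann problem on each
edge. The first two factors do not depend on `α` and cancel when two operators are compared. -/
theorem det_charMatrix_neg_sq (α : Fin N → ℝ) {s : ℝ} (hs : 0 < s) :
    (Γ.charMatrix α (-(s : ℂ) ^ 2)).det =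
      (LinearMap.toMatrix' (Γ.solNormalDerivMap (-(s : ℂ) ^ 2))).det *
        ((-(s : ℂ)⁻¹) ^ N * (Γ.vertexMatrix α s).det) := by
  have hs' : (s : ℂ) ≠ 0 := by exact_mod_cast hs.ne'
  set Y := LinearMap.toMatrix' (Γ.neumannCoeff s) with hY
  set A := LinearMap.toMatrix' (Γ.solNormalDerivMap (-(s : ℂ) ^ 2)) with hA
  set V := LinearMap.toMatrix' (Γ.solValueMap (-(s : ℂ) ^ 2)) with hV
  have hAY : A * Y = 1 := by
    rw [hA, hY, ← LinearMap.toMatrix'_comp, ← LinearMap.toMatrix'_id]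
    congr 1
    exact LinearMap.ext (Γ.solNormalDerivMap_neumannCoeff hs)
  have hR : V * Y = (-(s : ℂ)⁻¹) • (Γ.neumannRemainder s + 1) := by
    rw [neumannRemainder, sub_add_cancel, smul_smul, LinearMap.toMatrix'_comp,
      neg_mul_neg, inv_mul_cancel₀ hs', one_smul]
  have h1 : Γ.charMatrix α (-(s : ℂ) ^ 2) * Matrix.fromBlocks 1 (Y * Γ.incidence) 0 1 =
      Matrix.fromBlocks A 0 (Γ.incidenceᵀ * V) ((-(s : ℂ)⁻¹) • Γ.vertexMatrix α s) := by
    rw [charMatrix, Matrix.fromBlocks_multiply, ← hA, ← hV]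
    congr 1
    · simp
    · rw [← Matrix.mul_assoc, hAY]
      simp
    · simp
    · have h2 : Γ.incidenceᵀ * V * (Y * Γ.incidence) = (-(s : ℂ)⁻¹) •
          (Γ.incidenceᵀ * Γ.neumannRemainder s * Γ.incidence +
            Matrix.diagonal fun v => (Γ.valence v : ℂ)) := by
        rw [Matrix.mul_assoc, ← Matrix.mul_assoc V, hR, ← incidence_transpose_mul_self,
          Matrix.smul_mul, Matrix.mul_smul, Matrix.add_mul, Matrix.mul_add, Matrix.one_mul,
          Matrix.mul_assoc]
      have h3 : (-Matrix.diagonal fun v => (α v : ℂ)) =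
          (-(s : ℂ)⁻¹) • (Matrix.diagonal fun v => (α v : ℂ) * s) := by
        rw [← Matrix.diagonal_smul, Matrix.diagonal_neg]
        congr 1
        funext v
        simp
        field_simp
      rw [h2, Matrix.mul_one, h3, ← smul_add, vertexMatrix, ← Matrix.diagonal_add]
      congr 1
      abel
  have h2 := congrArg Matrix.det h1
  rw [Matrix.det_mul, Matrix.det_fromBlocks_zero₂₁, Matrix.det_fromBlocks_zero₁₂,
    Matrix.det_one, Matrix.det_one, mul_one, mul_one, Matrix.det_smul, Fintype.card_fin] at h2
  exact h2

theorem det_solNormalDerivMap_ne_zero {s : ℝ} (hs : 0 < s) :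
    (LinearMap.toMatrix' (Γ.solNormalDerivMap (-(s : ℂ) ^ 2))).det ≠ 0 := by
  have h : LinearMap.toMatrix' (Γ.solNormalDerivMap (-(s : ℂ) ^ 2)) *
      LinearMap.toMatrix' (Γ.neumannCoeff s) = 1 := by
    rw [← LinearMap.toMatrix'_comp, ← LinearMap.toMatrix'_id]
    congr 1
    exact LinearMap.ext (Γ.solNormalDerivMap_neumannCoeff hs)
  exact Matrix.det_ne_zero_of_right_inverse h

/-- The polynomial approximated by the determinant of `vertexMatrix`. -/
def vertexPoly (α : Fin N → ℝ) : Polynomial ℂ :=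
  ∏ v, (Polynomial.C (α v : ℂ) * Polynomial.X + Polynomial.C (Γ.valence v : ℂ))

theorem isAsympPoly_det_vertexMatrix (α : Fin N → ℝ) :
    IsAsympPoly (fun s => (Γ.vertexMatrix α s).det) (Γ.vertexPoly α) := by
  rw [vertexPoly, ← Matrix.det_diagonal]
  refine IsAsympPoly.det fun v w => ?_
  have h1 : IsAsympPoly
      (fun s => (Γ.incidenceᵀ * Γ.neumannRemainder s * Γ.incidence) v w) 0 := by
    simp only [Matrix.mul_apply]
    have h2 := IsAsympPoly.sum (t := Finset.univ) fun q (_ : q ∈ Finset.univ) =>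
      (IsAsympPoly.sum (t := Finset.univ) fun p (_ : p ∈ Finset.univ) =>
        (Γ.isAsympPoly_neumannRemainder p q).const_mul (Γ.incidenceᵀ v p)).mul
          (isAsympPoly_eval (Polynomial.C (Γ.incidence q w)))
    simpa using h2
  have h3 : IsAsympPoly (fun s : ℝ => Matrix.diagonal
      (fun v => (α v : ℂ) * s + (Γ.valence v : ℂ)) v w)
      (Matrix.diagonal (fun v => Polynomial.C (α v : ℂ) * Polynomial.X +
        Polynomial.C (Γ.valence v : ℂ)) v w) := by
    refine (isAsympPoly_eval _).congr (Eventually.of_forall fun s => ?_)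
    simp only [Matrix.diagonal_apply]
    split_ifs <;> simp
  simpa [vertexMatrix] using h3.add h1

theorem exists_const_mul_vertexPoly {α β : Fin N → ℝ}
    (h : spectralMultiplicity (laplacian Γ α) = spectralMultiplicity (laplacian Γ β)) :
    ∃ c : ℂ, c ≠ 0 ∧ Γ.vertexPoly α = Polynomial.C c * Γ.vertexPoly β := by
  obtain ⟨c, hc, hdet⟩ := Γ.exists_const_mul_det_charMatrix h
  refine ⟨c, hc, (Γ.isAsympPoly_det_vertexMatrix α).unique
    (((Γ.isAsympPoly_det_vertexMatrix β).const_mul c).congr ?_)⟩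
  filter_upwards [eventually_gt_atTop 0] with s hs
  have hs' : (s : ℂ) ≠ 0 := by exact_mod_cast hs.ne'
  have h1 := hdet (-(s : ℂ) ^ 2)
  rw [det_charMatrix_neg_sq _ _ hs, det_charMatrix_neg_sq _ _ hs, mul_left_comm c] at h1
  have h2 := mul_left_cancel₀ (Γ.det_solNormalDerivMap_ne_zero hs) h1
  rw [mul_left_comm c] at h2
  exact (mul_left_cancel₀ (pow_ne_zero _ (neg_ne_zero.2 (inv_ne_zero hs'))) h2).symm

/-- Nonzero coupling constants make every factor of `vertexPoly` of degree one, so its roots are all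
the `-γ_v / α_v`, with multiplicity. Proportional polynomials have the same multiset of roots, hence
the same power sums. -/
theorem sum_valence_div_pow_eq {α β : Fin N → ℝ} (hα : ∀ v, α v ≠ 0) (hβ : ∀ v, β v ≠ 0)
    (h : spectralMultiplicity (laplacian Γ α) = spectralMultiplicity (laplacian Γ β)) (m : ℕ) :
    ∑ v, ((α v)⁻¹ * Γ.valence v) ^ m = ∑ v, ((β v)⁻¹ * Γ.valence v) ^ m := by
  have hroots : ∀ δ : Fin N → ℝ, (∀ v, δ v ≠ 0) → (Γ.vertexPoly δ).roots =
      Finset.univ.val.map fun v => -((δ v : ℂ)⁻¹ * (Γ.valence v : ℂ)) := by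
    intro δ hδ
    have hδ' : ∀ v, (δ v : ℂ) ≠ 0 := fun v => by exact_mod_cast hδ v
    rw [vertexPoly, Polynomial.roots_prod]
    · simp only [Polynomial.roots_C_mul_X_add_C _ (hδ' _)]
      exact Multiset.bind_singleton _ _
    · refine Finset.prod_ne_zero_iff.2 fun v _ h0 => ?_
      have := congrArg (fun p => Polynomial.coeff p 1) h0
      simp [hδ v] at this
  obtain ⟨c, hc, hP⟩ := Γ.exists_const_mul_vertexPoly h
  have h1 := congrArg Polynomial.roots hP
  rw [Polynomial.roots_C_mul _ hc, hroots α hα, hroots β hβ] at h1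
  have h2 := congrArg (fun s => (s.map fun x : ℂ => (-x) ^ m).sum) h1
  simp only [Multiset.map_map, Function.comp_def, neg_neg] at h2
  have h3 : ∑ v, ((α v : ℂ)⁻¹ * (Γ.valence v : ℂ)) ^ m =
      ∑ v, ((β v : ℂ)⁻¹ * (Γ.valence v : ℂ)) ^ m := h2
  exact_mod_cast h3

end MetricGraph

/-! ### The binomial identity and the trace formula. -/

theorem sum_alternating_choose_pow (a d : ℝ) {m : ℕ} (hm : 1 ≤ m) :
    ∑ j ∈ Finset.Icc 1 m, (-1 : ℝ) ^ j / (j : ℝ) * ((m - 1).choose (m - j) : ℝ) *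
      (d ^ j * a ^ (m - j)) = ((a - d) ^ m - a ^ m) / m := by
  have hm0 : (m : ℝ) ≠ 0 := by positivity
  have h1 : (a - d) ^ m = a ^ m + ∑ j ∈ Finset.Icc 1 m, (-d) ^ j * a ^ (m - j) * (m.choose j) := by
    rw [sub_eq_neg_add, add_pow, Finset.range_eq_Ico, Finset.sum_eq_sum_Ico_succ_bot (by lia)]
    simp only [pow_zero, one_mul, Nat.sub_zero, Nat.choose_zero_right, Nat.cast_one, mul_one]
    rfl
  rw [h1, add_sub_cancel_left, Finset.sum_div]
  refine Finset.sum_congr rfl fun j hj => ?_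
  obtain ⟨hj1, hjm⟩ := Finset.mem_Icc.1 hj
  have hj0 : (j : ℝ) ≠ 0 := by positivity
  -- This turns `(1/j) C(m-1, m-j)` into `(1/m) C(m, j)`, so the sum is `1/m` times the expansion of
  -- `(a - d)^m` without its `j = 0` term `a^m`.
  have h2 : m * (m - 1).choose (m - j) = m.choose j * j := by
    obtain ⟨k, rfl⟩ : ∃ k, m = k + 1 := ⟨m - 1, by lia⟩
    obtain ⟨i, rfl⟩ : ∃ i, j = i + 1 := ⟨j - 1, by lia⟩
    rw [Nat.add_sub_cancel, Nat.add_sub_add_right, Nat.choose_symm (by lia)]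
    exact Nat.add_one_mul_choose_eq k i
  have h3 : (m : ℝ) * ((m - 1).choose (m - j) : ℝ) = (m.choose j : ℝ) * j := by exact_mod_cast h2
  rw [neg_pow d, div_mul_eq_mul_div, div_mul_eq_mul_div, div_eq_div_iff hj0 hm0]
  linear_combination (-1 : ℝ) ^ j * d ^ j * a ^ (m - j) * h3

end QuantumGraph

end

theorem theorem3p3 {n N : ℕ} (Γ : QuantumGraph.MetricGraph n N)
    (α₁ α₂ : Fin N → ℝ) (B₁ B₂ D : Matrix (Fin N) (Fin N) ℝ)
    (hB₁ : B₁ = Matrix.diagonal α₁) (hB₂ : B₂ = Matrix.diagonal α₂)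
    (hspec : QuantumGraph.spectralMultiplicity (QuantumGraph.laplacian Γ α₁) =
      QuantumGraph.spectralMultiplicity (QuantumGraph.laplacian Γ α₂))
    (hinv₁ : IsUnit B₁) (hinv₂ : IsUnit B₂)
    (hD : D = B₂⁻¹ - B₁⁻¹) (m : ℕ) (hm : 1 ≤ m) :
    ∑ j ∈ Finset.Icc 1 m, (-1 : ℝ) ^ j / (j : ℝ) * ((m - 1).choose (m - j) : ℝ) *
      Matrix.trace (D ^ j * B₂ ^ (-(m : ℤ) + (j : ℤ)) * Γ.valenceMatrix ^ m) = 0 := by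
  subst hB₁ hB₂
  have h0 : ∀ α : Fin N → ℝ, IsUnit (Matrix.diagonal α) → ∀ v, α v ≠ 0 := fun α hα v =>
    (Pi.isUnit_iff.1 (Matrix.isUnit_diagonal.1 hα) v).ne_zero
  have hinv : ∀ α : Fin N → ℝ, (∀ v, α v ≠ 0) →
      (Matrix.diagonal α)⁻¹ = Matrix.diagonal fun v => (α v)⁻¹ := by
    intro α hα
    refine Matrix.inv_eq_right_inv ?_
    rw [Matrix.diagonal_mul_diagonal, ← Matrix.diagonal_one]
    congr 1
    funext v
    exact mul_inv_cancel₀ (hα v)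
  have h1 := h0 α₁ hinv₁
  have h2 := h0 α₂ hinv₂
  -- All matrices are diagonal, so the traces become sums over vertices and the identity for real
  -- numbers applies at each vertex, with `a = (α₂ v)⁻¹` and `a - d = (α₁ v)⁻¹`.
  have htr : ∀ j ∈ Finset.Icc 1 m, (-1 : ℝ) ^ j / (j : ℝ) * ((m - 1).choose (m - j) : ℝ) *
      Matrix.trace (D ^ j * Matrix.diagonal α₂ ^ (-(m : ℤ) + (j : ℤ)) * Γ.valenceMatrix ^ m) =
      ∑ v, (Γ.valence v : ℝ) ^ m * ((-1 : ℝ) ^ j / (j : ℝ) * ((m - 1).choose (m - j) : ℝ) *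
        (((α₂ v)⁻¹ - (α₁ v)⁻¹) ^ j * (α₂ v)⁻¹ ^ (m - j))) := by
    intro j hj
    have hjm := (Finset.mem_Icc.1 hj).2
    have he : -(m : ℤ) + (j : ℤ) = -((m - j : ℕ) : ℤ) := by lia
    rw [hD, hinv _ h1, hinv _ h2, Matrix.diagonal_sub, he, Matrix.zpow_neg_natCast,
      ← Matrix.inv_pow', hinv _ h2, QuantumGraph.MetricGraph.valenceMatrix, Matrix.diagonal_pow,
      Matrix.diagonal_pow, Matrix.diagonal_pow, Matrix.diagonal_mul_diagonal,
      Matrix.diagonal_mul_diagonal, Matrix.trace_diagonal, Finset.mul_sum]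
    refine Finset.sum_congr rfl fun v _ => ?_
    simp only [Pi.pow_apply]
    ring
  rw [Finset.sum_congr rfl htr, Finset.sum_comm]
  simp only [← Finset.mul_sum, QuantumGraph.sum_alternating_choose_pow _ _ hm]
  have h3 := Γ.sum_valence_div_pow_eq h1 h2 hspec m
  simp only [mul_pow] at h3
  have h4 : ∀ v, (Γ.valence v : ℝ) ^ m *
      ((((α₂ v)⁻¹ - ((α₂ v)⁻¹ - (α₁ v)⁻¹)) ^ m - (α₂ v)⁻¹ ^ m) / m) =
      ((α₁ v)⁻¹ ^ m * (Γ.valence v : ℝ) ^ m - (α₂ v)⁻¹ ^ m * (Γ.valence v : ℝ) ^ m) / m := by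
    intro v
    rw [sub_sub_cancel]
    ring
  rw [Finset.sum_congr rfl fun v _ => h4 v, ← Finset.sum_div, Finset.sum_sub_distrib, h3,
    sub_self, zero_div]
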